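/- Let $d\ge 2$ and $k\ge 1$. An HMM of order $k$ over the alphabet $[d]=\{1,\dots,d\}$ is a pair $(Q,O)$ of entrywise nonnegative, column stochastic matrices $Q\in\mathbb R^{k\times k}$, $O\in\mathbb R^{d\times k}$; $Q_{j,i}=\mathbb P(x_{t+1}=j\mid x_t=i)$, $O_{j,i}=\mathbb P(y_t=j\mid x_t=i)$, and its output process is that of the chain started from a stationary distribution $\pi$, $Q\pi=\pi$. Let $\Theta_{(d,k)}$ be the set of all these pairs; measure zero refers to Lebesgue measure on the affine space $\{(Q,O): e^\top Q=e^\top,\ e^\top O=e^\top\}$ ($e$ is the all-ones vector). There is a measure zero set $\mathcal E\subset\Theta_{(d,k)}$ such that every $(Q,O)\in\Theta_{(d,k)}\setminus\mathcal E$ has exactly one stationary distribution $\pi$, $\pi_i>0$ for all $i$, and the following holds for every $n\in\mathbb N$ with $n>8\lceil\log_d k\rceil$. Put $N=2n+1$, let $\mathcal P^{(N)}$ be the table of the probabilities of all output strings of length $N$, and let $M\in\mathbb R^{d^n\times d^n\times d}$ be the tensor $M_{(l_1,\dots,l_n),(l_{-1},\dots,l_{-n}),l_0}=\mathbb P(y_{-n}=l_{-n},\dots,y_n=l_n)$.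 With $\odot$ the columnwise Kronecker (Khatri–Rao) product and $\widetilde Q=\mathrm{Diag}(\pi)Q^\top\mathrm{Diag}(\pi)^{-1}$, let $A=A^{(n)}$, $B=B^{(n)}$, $C=O\,\mathrm{Diag}(\pi)$, where $A^{(1)}=OQ$, $A^{(m)}=(O\odot A^{(m-1)})Q$, $B^{(1)}=O\widetilde Q$, $B^{(m)}=(O\odot B^{(m-1)})\widetilde Q$. 1. $A$ and $B$ have full column rank $k$, and $M=\sum_{i=1}^k A_{[:,i]}\otimes B_{[:,i]}\otimes C_{[:,i]}$. Every decomposition of $M$ into rank-one tensors has at least $k$ terms, and one with exactly $k$ terms agrees with this one up to a common permutation of the columns and scalings of the columns by $a_i,b_i,c_i$ with $a_ib_ic_i=1$. 2. The minimal HMM realization is determined by $\mathcal P^{(N)}$: every HMM $(Q',O')$ with a stationary distribution $\pi'$ that has the same probabilities of length $N$ strings has order at least $k$, and if its order is $k$ then $(Q',O',\pi')$ is obtained from $(Q,O,\pi)$ by a permutation of the hidden states. 3. The minimal HMM realization is computed from $\mathcal P^{(N)}$ by the following procedure. For unit vectors $v_1,v_2\in\mathbb R^d$ put $M_1=M(I,I,v_1)$,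 $M_2=M(I,I,v_2)$ and let $X^\dagger$ denote the Moore–Penrose inverse. Take eigen-decompositions on the nonzero eigenvalues $M_1M_2^\dagger=\hat A\Lambda\hat A^\dagger$ and $M_2^\top(M_1^\top)^\dagger=\hat B\Lambda^{-1}\hat B^\dagger$, with $\hat A,\hat B$ of full column rank, $\Lambda$ an invertible diagonal matrix, and all columns of $\hat A$ and $\hat B$ scaled to sum one; let $\hat k$ be the number of these eigenvalues, and $\hat C=\overline M^{(3)}\big((\hat A\odot\hat B)^\dagger\big)^\top$ with $\overline M^{(3)}\in\mathbb R^{d\times d^{2n}}$ the matricization of $M$ along the third mode. Return $\hat k$, $\hat O$ with columns $\hat O_{[:,i]}=\hat C_{[:,i]}/(e^\top\hat C_{[:,i]})$, and $\hat Q=(\hat O\odot\hat A^{(n-1)})^\dagger\hat A$, where $\hat A^{(n-1)}$ is the marginal of $\hat A$ on the first $n-1$ letters. For almost every pair $(v_1,v_2)$ of unit vectors, with respect to the product of the uniform measures on the sphere, this procedure has an output, and every output satisfies $\hat k=k$ and $(\hat Q,\hat O)=(Q,O)$ up to a permutation of the hidden states. 4. The same HMM gives the minimal quasi-HMM realization.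 Here a quasi-HMM of order $k'$ is a tuple $(u,v,T^{(1)},\dots,T^{(d)})$, $u,v\in\mathbb R^{k'}$, $T^{(j)}\in\mathbb R^{k'\times k'}$, with $u^\top\sum_jT^{(j)}=u^\top$ and $\sum_jT^{(j)}v=v$, which assigns to a string $l_1\cdots l_m$ the number $u^\top T^{(l_m)}\cdots T^{(l_1)}v$. The tuple $(e,\pi,Q\,\mathrm{Diag}(O_{[j,:]}):j\in[d])$ assigns to every string of length at least one its probability; every quasi-HMM that agrees with $\mathcal P^{(N)}$ on the strings of length $N$ has order at least $k$; and if it has order $k$, it is $(S^\top e,\;S^{-1}\pi,\;S^{-1}Q\,\mathrm{Diag}(O_{[j,:]})S:j\in[d])$ for some invertible $S\in\mathbb R^{k\times k}$. -/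

import Mathlib

open MeasureTheory

noncomputable section

/-- A hidden Markov model with output alphabet `Fin d` and hidden states `Fin k`, given by its
transition matrix `Q i j = P(x_{t+1} = i | x_t = j)` and its observation matrix
`O a i = P(y_t = a | x_t = i)`, both column stochastic. -/
structure HMM (d k : ℕ) where
  Q : Matrix (Fin k) (Fin k) ℝ
  O : Matrix (Fin d) (Fin k) ℝ
  Q_nonneg : ∀ i j, 0 ≤ Q i j
  Q_sum : ∀ j, ∑ i, Q i j = 1
  O_nonneg : ∀ a i, 0 ≤ O a i
  O_sum : ∀ i, ∑ a, O a i = 1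

/-- Affine coordinates on the space of pairs of column stochastic matrices: all entries except
those of the last rows (which are determined by the column sums). -/
def HMM.coords {d k : ℕ} (θ : HMM d k) :
    ({i : Fin k // (i : ℕ) + 1 < k} → Fin k → ℝ) × ({a : Fin d // (a : ℕ) + 1 < d} → Fin k → ℝ) :=
  (fun i j => θ.Q i j, fun a i => θ.O a i)

/-- A set of HMMs has measure zero if it is Lebesgue null in the affine space
`{(Q, O) : eᵀ Q = eᵀ, eᵀ O = eᵀ}`. -/
def HMM.MeasureZero {d k : ℕ} (E : Set (HMM d k)) : Prop :=
  volume (HMM.coords '' E) = 0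

/-- `p` is a stationary state distribution. -/
def HMM.IsStationary {d k : ℕ} (θ : HMM d k) (p : Fin k → ℝ) : Prop :=
  (∀ i, 0 ≤ p i) ∧ ∑ i, p i = 1 ∧ θ.Q.mulVec p = p

/-- The probability that `L + 1` consecutive outputs of the HMM, started from the state
distribution `p`, form the string `l` (sum over all paths of hidden states). -/
def HMM.prob {d k : ℕ} (θ : HMM d k) (p : Fin k → ℝ) {L : ℕ} (l : Fin (L + 1) → Fin d) : ℝ :=
  ∑ x : Fin (L + 1) → Fin k,
    p (x 0) * (∏ t : Fin L, θ.Q (x t.succ) (x t.castSucc)) * ∏ t : Fin (L + 1), θ.O (l t) (x t)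

/-- The backward transition matrix `Diag(p) Qᵀ Diag(p)⁻¹`. -/
def HMM.backward {d k : ℕ} (θ : HMM d k) (p : Fin k → ℝ) : Matrix (Fin k) (Fin k) ℝ :=
  Matrix.diagonal p * θ.Q.transpose * (Matrix.diagonal p)⁻¹

/-- The Khatri-Rao (columnwise Kronecker) product, rows indexed by pairs. -/
def khatriRao {m n c : Type*} (X : Matrix m c ℝ) (Y : Matrix n c ℝ) : Matrix (m × n) c ℝ :=
  Matrix.of fun r i => X r.1 i * Y r.2 i

/-- The Khatri-Rao product `O ⊙ Y` of a matrix with rows indexed by letters and one with rows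
indexed by strings of length `n`, with rows indexed by strings of length `n + 1`. -/
def khatriRaoCons {d k n : ℕ} (O : Matrix (Fin d) (Fin k) ℝ)
    (Y : Matrix (Fin n → Fin d) (Fin k) ℝ) : Matrix (Fin (n + 1) → Fin d) (Fin k) ℝ :=
  Matrix.of fun w i => O (w 0) i * Y (Fin.tail w) i

/-- The matrices `A⁽ⁿ⁾ = (O ⊙ A⁽ⁿ⁻¹⁾) Q`, `A⁽¹⁾ = O Q`, of the conditional probabilities
`P(y_1 ⋯ y_n = w | x_0 = i)` of a chain with transition matrix `Q`. -/
def condMatrix {d k : ℕ} (Q : Matrix (Fin k) (Fin k) ℝ) (O : Matrix (Fin d) (Fin k) ℝ) :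
    (n : ℕ) → Matrix (Fin n → Fin d) (Fin k) ℝ
  | 0 => Matrix.of fun _ _ => 1
  | n + 1 => khatriRaoCons O (condMatrix Q O n) * Q

/-- The factor `A`: `P(y_1 ⋯ y_n = w | x_0 = i)`. -/
def HMM.factorA {d k : ℕ} (θ : HMM d k) (n : ℕ) : Matrix (Fin n → Fin d) (Fin k) ℝ :=
  condMatrix θ.Q θ.O n

/-- The factor `B`: `P(y_{-1} ⋯ y_{-n} = w | x_0 = i)`. -/
def HMM.factorB {d k : ℕ} (θ : HMM d k) (p : Fin k → ℝ) (n : ℕ) :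
    Matrix (Fin n → Fin d) (Fin k) ℝ :=
  condMatrix (θ.backward p) θ.O n

/-- The factor `C`: `P(y_0 = a, x_0 = i)`. -/
def HMM.factorC {d k : ℕ} (θ : HMM d k) (p : Fin k → ℝ) : Matrix (Fin d) (Fin k) ℝ :=
  θ.O * Matrix.diagonal p

/-- The string `l_{-n} ⋯ l_{-1} l_0 l_1 ⋯ l_n`, from the future `l_1 ⋯ l_n`, the past
`l_{-1} ⋯ l_{-n}` (read backward in time) and the present letter `l_0`. -/
def joinString {d n : ℕ} (future past : Fin n → Fin d) (a : Fin d) : Fin (2 * n + 1) → Fin d :=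
  fun t =>
    if h : (t : ℕ) < n then past ⟨n - 1 - t, by omega⟩
    else if h' : (t : ℕ) = n then a
    else future ⟨t - n - 1, by omega⟩

/-- The third order tensor `M` formed from a table of probabilities of strings of length
`2 n + 1`. -/
def tensorM {d n : ℕ} (P : (Fin (2 * n + 1) → Fin d) → ℝ)
    (future past : Fin n → Fin d) (a : Fin d) : ℝ :=
  P (joinString future past a)

/-- The tensor `A ⊗ B ⊗ C = ∑ i, A_i ⊗ B_i ⊗ C_i`. -/
def tensorOf {m₁ m₂ m₃ : Type*} {k : ℕ} (A : Matrix m₁ (Fin k) ℝ) (B : Matrix m₂ (Fin k) ℝ)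
    (C : Matrix m₃ (Fin k) ℝ) (j₁ : m₁) (j₂ : m₂) (j₃ : m₃) : ℝ :=
  ∑ i, A j₁ i * B j₂ i * C j₃ i

/-- The projection `M(I, I, v)` of a tensor along its third mode. -/
def contract {m₁ m₂ : Type*} {d : ℕ} (M : m₁ → m₂ → Fin d → ℝ) (v : EuclideanSpace ℝ (Fin d)) :
    Matrix m₁ m₂ ℝ :=
  Matrix.of fun j₁ j₂ => ∑ a, M j₁ j₂ a * v a

/-- The matricization of a tensor along its third mode. -/
def matricize₃ {m₁ m₂ m₃ : Type*} (M : m₁ → m₂ → m₃ → ℝ) : Matrix m₃ (m₁ × m₂) ℝ :=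
  Matrix.of fun j₃ j => M j.1 j.2 j₃

/-- `Y` is the Moore-Penrose pseudo-inverse of `X`. -/
def IsPseudoInverse {m n : Type*} [Fintype m] [Fintype n] (X : Matrix m n ℝ) (Y : Matrix n m ℝ) :
    Prop :=
  X * Y * X = X ∧ Y * X * Y = Y ∧ (X * Y).transpose = X * Y ∧ (Y * X).transpose = Y * X

/-- The pseudo-inverse `(Xᵀ X)⁻¹ Xᵀ` of a matrix `X` of full column rank. -/
def pinv {m : Type*} [Fintype m] {k : ℕ} (X : Matrix m (Fin k) ℝ) : Matrix (Fin k) m ℝ :=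
  (X.transpose * X)⁻¹ * X.transpose

/-- The marginal on the first `n` letters of (columns of) distributions on strings of length
`n + 1`. -/
def marginalize {d k n : ℕ} (A : Matrix (Fin (n + 1) → Fin d) (Fin k) ℝ) :
    Matrix (Fin n → Fin d) (Fin k) ℝ :=
  Matrix.of fun w i => ∑ a, A (Fin.snoc w a) i

/-- The observation matrix read off from `C` by scaling each column to have sum one. -/
def recoverO {d k : ℕ} (C : Matrix (Fin d) (Fin k) ℝ) : Matrix (Fin d) (Fin k) ℝ :=
  Matrix.of fun a i => C a i / ∑ b, C b i

/-- The transition matrix `(O ⊙ A⁽ⁿ⁻¹⁾)† A` read off from `O` and `A = A⁽ⁿ⁾`, for `n ≥ 1`. -/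
def recoverQ {d k : ℕ} (O : Matrix (Fin d) (Fin k) ℝ) :
    (n : ℕ) → Matrix (Fin n → Fin d) (Fin k) ℝ → Matrix (Fin k) (Fin k) ℝ
  | 0, _ => 0
  | _ + 1, A => pinv (khatriRaoCons O (marginalize A)) * A

/-- `(A, B, C)`, with `k` columns each, is an output of tensor decomposition by simultaneous
diagonalization, on the input tensor `M` and with the vectors `v₁`, `v₂`: with `M₁ = M(I, I, v₁)`,
`M₂ = M(I, I, v₂)`, one takes eigen-decompositions `M₁ M₂† = A Λ A†` and `M₂ᵀ (M₁ᵀ)† = B Λ⁻¹ B†`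
restricted to the nonzero eigenvalues, whose number is `k`, paired by reciprocal eigenvalues and
with eigenvectors scaled to have sum one, and then solves the matricized tensor for `C`. -/
def IsDecompositionOutput {m : Type*} [Fintype m] {d : ℕ} (M : m → m → Fin d → ℝ)
    (v₁ v₂ : EuclideanSpace ℝ (Fin d)) {k : ℕ} (A B : Matrix m (Fin k) ℝ)
    (C : Matrix (Fin d) (Fin k) ℝ) : Prop :=
  ∃ (M₁inv M₂inv : Matrix m m ℝ) (Λ : Fin k → ℝ),
    IsPseudoInverse (contract M v₁) M₁inv ∧ IsPseudoInverse (contract M v₂) M₂inv ∧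
    (∀ i, Λ i ≠ 0) ∧ A.rank = k ∧ B.rank = k ∧
    contract M v₁ * M₂inv = A * Matrix.diagonal Λ * pinv A ∧
    (contract M v₂).transpose * M₁inv.transpose
      = B * Matrix.diagonal (fun i => (Λ i)⁻¹) * pinv B ∧
    (∀ i, ∑ w, A w i = 1) ∧ (∀ i, ∑ w, B w i = 1) ∧
    C = matricize₃ M * (pinv (khatriRao A B)).transpose

/-- `(Q, O)`, with `k` states, is an output of the HMM realization procedure on the table `P` of
probabilities of strings of length `2 n + 1`: decompose the tensor `M` formed from `P`, then
recover `O` and `Q` from the factors. -/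
def IsRealizationOutput {d n : ℕ} (P : (Fin (2 * n + 1) → Fin d) → ℝ)
    (v₁ v₂ : EuclideanSpace ℝ (Fin d)) {k : ℕ} (Q : Matrix (Fin k) (Fin k) ℝ)
    (O : Matrix (Fin d) (Fin k) ℝ) : Prop :=
  ∃ (A B : Matrix (Fin n → Fin d) (Fin k) ℝ) (C : Matrix (Fin d) (Fin k) ℝ),
    IsDecompositionOutput (tensorM P) v₁ v₂ A B C ∧ O = recoverO C ∧ Q = recoverQ O n A

/-- The uniform (surface) measure on the unit sphere of `ℝ^d`. -/
def sphereMeasure (d : ℕ) : Measure (Metric.sphere (0 : EuclideanSpace ℝ (Fin d)) 1) :=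
  (volume : Measure (EuclideanSpace ℝ (Fin d))).toSphere

/-- A quasi-HMM of order `k` with output alphabet `Fin d`. -/
structure QuasiHMM (d k : ℕ) where
  u : Fin k → ℝ
  v : Fin k → ℝ
  T : Fin d → Matrix (Fin k) (Fin k) ℝ
  u_norm : Matrix.vecMul u (∑ a, T a) = u
  v_norm : (∑ a, T a).mulVec v = v

/-- The number `uᵀ T_{l_N} ⋯ T_{l_1} v` which the quasi-HMM attaches to `l_1 ⋯ l_N`. -/
def QuasiHMM.prob {d k : ℕ} (q : QuasiHMM d k) {N : ℕ} (l : Fin N → Fin d) : ℝ :=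
  dotProduct q.u ((List.ofFn l).foldl (fun w a => (q.T a).mulVec w) q.v)

/-- Equivalence of quasi-HMMs: equality up to a change of basis of the state space. -/
def QuasiHMM.Equivalent {d k : ℕ} (q q' : QuasiHMM d k) : Prop :=
  ∃ S : Matrix (Fin k) (Fin k) ℝ, IsUnit S.det ∧
    q'.u = S.transpose.mulVec q.u ∧ q'.v = S⁻¹.mulVec q.v ∧ ∀ a, q'.T a = S⁻¹ * q.T a * S

theorem HMM.sum_quasi {d k : ℕ} (θ : HMM d k) :
    ∑ a, θ.Q * Matrix.diagonal (θ.O a) = θ.Q := by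
  rw [← Finset.mul_sum]
  have : ∑ a, Matrix.diagonal (θ.O a) = (1 : Matrix (Fin k) (Fin k) ℝ) := by
    ext i j
    rw [Matrix.sum_apply]
    by_cases h : i = j
    · subst h
      simp [θ.O_sum]
    · simp [Matrix.diagonal, h]
  rw [this, mul_one]

/-- The quasi-HMM `u = e`, `v = p`, `T a = Q Diag(O_{[a,:]})` of an HMM with stationary state
distribution `p`. -/
def HMM.toQuasi {d k : ℕ} (θ : HMM d k) (p : Fin k → ℝ) (hp : θ.IsStationary p) :
    QuasiHMM d k where
  u := fun _ => 1
  v := p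
  T := fun a => θ.Q * Matrix.diagonal (θ.O a)
  u_norm := by
    rw [θ.sum_quasi]
    ext j
    simpa [Matrix.vecMul, dotProduct] using θ.Q_sum j
  v_norm := by
    rw [θ.sum_quasi]
    exact hp.2.2

end

noncomputable section

namespace Matrix

theorem isUnit_det_of_rank_eq {k : ℕ} {X : Matrix (Fin k) (Fin k) ℝ} (h : X.rank = k) :
    IsUnit X.det := by
  rw [← isUnit_iff_isUnit_det, ← mulVec_surjective_iff_isUnit]
  have hr : LinearMap.range X.mulVecLin = ⊤ := by
    apply Submodule.eq_top_of_finrank_eq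
    rw [show Module.finrank ℝ (LinearMap.range X.mulVecLin) = k from h]
    simp
  exact LinearMap.range_eq_top.mp hr

theorem rank_eq_of_leftInverse {m : Type*} [Fintype m] {k : ℕ} {A : Matrix m (Fin k) ℝ}
    {L : Matrix (Fin k) m ℝ} (h : L * A = 1) : A.rank = k := by
  apply le_antisymm
  · simpa using A.rank_le_card_width
  · have := rank_mul_le_right L A
    rwa [h, rank_one, Fintype.card_fin] at this

theorem rank_eq_of_isUnit_det_mul {m : Type*} [Fintype m] {k : ℕ} {X : Matrix (Fin k) m ℝ}
    {A : Matrix m (Fin k) ℝ} (h : IsUnit (X * A).det) : A.rank = k := by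
  apply rank_eq_of_leftInverse (L := (X * A)⁻¹ * X)
  rw [Matrix.mul_assoc, nonsing_inv_mul _ h]

theorem rank_eq_of_rank_mul {m : Type*} [Fintype m] {k : ℕ} {A : Matrix m (Fin k) ℝ}
    {X : Matrix (Fin k) (Fin k) ℝ} (h : (A * X).rank = k) : A.rank = k := by
  apply le_antisymm
  · simpa using A.rank_le_card_width
  · exact h.symm.le.trans (rank_mul_le_left A X)

theorem isUnit_det_gram {m : Type*} [Fintype m] {k : ℕ} {A : Matrix m (Fin k) ℝ}
    (h : A.rank = k) : IsUnit (A.transpose * A).det :=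
  isUnit_det_of_rank_eq ((rank_transpose_mul_self A).trans h)

theorem pinv_mul {m : Type*} [Fintype m] {k : ℕ} {A : Matrix m (Fin k) ℝ}
    (h : A.rank = k) : pinv A * A = 1 := by
  rw [pinv, Matrix.mul_assoc, nonsing_inv_mul _ (isUnit_det_gram h)]

theorem mul_left_cancel_of_rank {m c : Type*} [Fintype m] {k : ℕ} {A : Matrix m (Fin k) ℝ}
    (h : A.rank = k) {X Y : Matrix (Fin k) c ℝ} (hXY : A * X = A * Y) : X = Y := by
  rw [← Matrix.one_mul X, ← Matrix.one_mul Y, ← pinv_mul h, Matrix.mul_assoc, hXY,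
    Matrix.mul_assoc]

theorem mul_right_cancel_of_rank {m c : Type*} [Fintype m] {k : ℕ} {A : Matrix m (Fin k) ℝ}
    (h : A.rank = k) {X Y : Matrix c (Fin k) ℝ} (hXY : X * A.transpose = Y * A.transpose) :
    X = Y := by
  apply transpose_injective
  apply mul_left_cancel_of_rank h
  simpa [transpose_mul] using congrArg transpose hXY

/-- A matrix intertwining diagonal matrices, the target ones being jointly separating, is a
permutation matrix up to scaling of its columns. -/
theorem exists_perm_of_intertwine {k : ℕ} {ι : Type*} {S : Matrix (Fin k) (Fin k) ℝ}
    (hS : IsUnit S.det) {g o : ι → Fin k → ℝ}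
    (hinj : ∀ i i', (∀ a, o a i = o a i') → i = i')
    (h : ∀ a, S * diagonal (g a) = diagonal (o a) * S) :
    ∃ σ : Fin k ≃ Fin k, (∀ i j, i ≠ σ j → S i j = 0) ∧ (∀ j, S (σ j) j ≠ 0) ∧
      ∀ a j, g a j = o a (σ j) := by
  have hent : ∀ a i j, S i j ≠ 0 → g a j = o a i := by
    intro a i j hij
    have := congrFun (congrFun (h a) i) j
    rw [mul_diagonal, diagonal_mul, mul_comm] at this
    exact mul_right_cancel₀ hij this
  have hcol : ∀ j, ∃ i, S i j ≠ 0 := by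
    intro j
    by_contra! hc
    exact hS.ne_zero (det_eq_zero_of_column_eq_zero j hc)
  have hrow : ∀ i, ∃ j, S i j ≠ 0 := by
    intro i
    by_contra! hc
    exact hS.ne_zero (det_eq_zero_of_row_eq_zero i hc)
  choose f hf using hcol
  have huniq : ∀ i j, S i j ≠ 0 → i = f j := fun i j hij =>
    hinj _ _ fun a => (hent a i j hij).symm.trans (hent a _ j (hf j))
  have hsurj : Function.Surjective f := fun i => by
    obtain ⟨j, hj⟩ := hrow i
    exact ⟨j, (huniq i j hj).symm⟩
  refine ⟨Equiv.ofBijective f ⟨Finite.injective_iff_surjective.mpr hsurj, hsurj⟩, ?_, hf,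
    fun a j => hent a _ j (hf j)⟩
  intro i j hij
  by_contra hne
  exact hij (huniq i j hne)

/-- Multiplying by a generalized permutation matrix permutes and scales the columns. -/
theorem mul_apply_of_perm {m : Type*} {k : ℕ} {S : Matrix (Fin k) (Fin k) ℝ}
    {σ : Fin k ≃ Fin k} (h : ∀ i j, i ≠ σ j → S i j = 0) (A : Matrix m (Fin k) ℝ) (w : m)
    (j : Fin k) : (A * S) w j = A w (σ j) * S (σ j) j := by
  rw [mul_apply, Finset.sum_eq_single (σ j)]
  · intro b _ hb
    rw [h b j hb, mul_zero]
  · simp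

theorem eq_submatrix_of_perm {m : Type*} [Fintype m] {k : ℕ} {S : Matrix (Fin k) (Fin k) ℝ}
    {σ : Fin k ≃ Fin k} (h : ∀ i j, i ≠ σ j → S i j = 0) {A A' : Matrix m (Fin k) ℝ}
    (hA : ∀ i, ∑ w, A w i = 1) (hA' : ∀ i, ∑ w, A' w i = 1) (hS : A' = A * S) :
    A' = A.submatrix id σ ∧ ∀ j, S (σ j) j = 1 := by
  have h1 : ∀ j, S (σ j) j = 1 := by
    intro j
    have := hA' j
    simp_rw [hS, mul_apply_of_perm h, ← Finset.sum_mul, hA, one_mul] at this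
    exact this
  refine ⟨?_, h1⟩
  ext w j
  rw [hS, mul_apply_of_perm h, h1, mul_one]
  rfl

theorem isPseudoInverse_unique {m n : Type*} [Fintype m] [Fintype n] {X : Matrix m n ℝ}
    {Y Z : Matrix n m ℝ} (hY : IsPseudoInverse X Y) (hZ : IsPseudoInverse X Z) : Y = Z := by
  obtain ⟨y1, y2, y3, y4⟩ := hY
  obtain ⟨z1, z2, z3, z4⟩ := hZ
  have e1 : X * Y = X * Z := by
    calc X * Y = X * Z * X * Y := by rw [z1]
      _ = (X * Z) * (X * Y) := by simp only [Matrix.mul_assoc]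
      _ = (X * Z).transpose * (X * Y).transpose := by rw [z3, y3]
      _ = ((X * Y) * (X * Z)).transpose := (transpose_mul (X * Y) (X * Z)).symm
      _ = (X * Z).transpose := by rw [← Matrix.mul_assoc, y1]
      _ = X * Z := z3
  have e2 : Y * X = Z * X := by
    calc Y * X = Y * (X * Z * X) := by rw [z1]
      _ = (Y * X) * (Z * X) := by simp only [Matrix.mul_assoc]
      _ = (Y * X).transpose * (Z * X).transpose := by rw [z4, y4]
      _ = ((Z * X) * (Y * X)).transpose := (transpose_mul (Z * X) (Y * X)).symm
      _ = (Z * (X * Y * X)).transpose := by simp only [Matrix.mul_assoc]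
      _ = (Z * X).transpose := by rw [y1]
      _ = Z * X := z4
  calc Y = Y * X * Y := y2.symm
    _ = Z * X * Y := by rw [e2]
    _ = Z * (X * Y) := by rw [Matrix.mul_assoc]
    _ = Z * X * Z := by rw [e1, Matrix.mul_assoc]
    _ = Z := z2

theorem isSymm_mul_pinv {m : Type*} [Fintype m] {k : ℕ} (A : Matrix m (Fin k) ℝ) :
    (A * pinv A).transpose = A * pinv A := by
  simp only [pinv, transpose_mul, transpose_nonsing_inv, transpose_transpose, Matrix.mul_assoc]

/-- The pseudo-inverse of a product `A D Bᵀ` with `A`, `B` of full column rank. -/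
theorem isPseudoInverse_mul {m n : Type*} [Fintype m] [Fintype n] {k : ℕ}
    {A : Matrix m (Fin k) ℝ} {B : Matrix n (Fin k) ℝ} (hA : A.rank = k) (hB : B.rank = k)
    {D D' : Matrix (Fin k) (Fin k) ℝ} (hD : D * D' = 1) :
    IsPseudoInverse (A * D * B.transpose) ((pinv B).transpose * D' * pinv A) := by
  have hA' := pinv_mul hA
  have hB' : B.transpose * (pinv B).transpose = 1 := by
    rw [← transpose_mul, pinv_mul hB, transpose_one]
  have hD' : D' * D = 1 := mul_eq_one_comm.mp hD
  have e1 : A * D * B.transpose * ((pinv B).transpose * D' * pinv A) = A * pinv A := by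
    calc _ = A * D * (B.transpose * (pinv B).transpose) * D' * pinv A := by
          simp only [Matrix.mul_assoc]
      _ = A * (D * D') * pinv A := by rw [hB']; simp only [Matrix.mul_assoc, Matrix.one_mul]
      _ = A * pinv A := by rw [hD, Matrix.mul_one]
  have e2 : (pinv B).transpose * D' * pinv A * (A * D * B.transpose)
      = (B * pinv B).transpose := by
    calc _ = (pinv B).transpose * D' * (pinv A * A) * D * B.transpose := by
          simp only [Matrix.mul_assoc]
      _ = (pinv B).transpose * (D' * D) * B.transpose := by
          rw [hA']; simp only [Matrix.mul_assoc, Matrix.one_mul]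
      _ = _ := by rw [hD', Matrix.mul_one, transpose_mul]
  refine ⟨?_, ?_, ?_, ?_⟩
  · rw [e1]
    calc A * pinv A * (A * D * B.transpose) = A * (pinv A * A) * D * B.transpose := by
          simp only [Matrix.mul_assoc]
      _ = _ := by rw [hA', Matrix.mul_one]
  · rw [Matrix.mul_assoc _ _ (_ * _ * pinv A), e1]
    calc _ = (pinv B).transpose * D' * (pinv A * A) * pinv A := by
          simp only [Matrix.mul_assoc]
      _ = _ := by rw [hA', Matrix.mul_one]
  · rw [e1, isSymm_mul_pinv]
  · rw [e2, transpose_transpose, isSymm_mul_pinv]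

end Matrix

section

open Matrix

theorem sum_fin_cons {d n : ℕ} {M : Type*} [AddCommMonoid M] (f : (Fin (n + 1) → Fin d) → M) :
    ∑ w, f w = ∑ a, ∑ w, f (Fin.cons a w) := by
  rw [← Fintype.sum_prod_type', ← (Fin.consEquiv fun _ => Fin d).sum_comp]
  rfl

theorem sum_fin_snoc {d n : ℕ} {M : Type*} [AddCommMonoid M] (f : (Fin (n + 1) → Fin d) → M) :
    ∑ w, f w = ∑ w, ∑ a, f (Fin.snoc w a) := by
  rw [Finset.sum_comm, ← Fintype.sum_prod_type', ← (Fin.snocEquiv fun _ => Fin d).sum_comp]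
  rfl

theorem tail_snoc {d n : ℕ} (w : Fin (n + 1) → Fin d) (a : Fin d) :
    Fin.tail (Fin.snoc (α := fun _ => Fin d) w a)
      = Fin.snoc (α := fun _ => Fin d) (Fin.tail w) a := by
  funext t
  refine Fin.lastCases ?_ (fun t => ?_) t
  · rw [Fin.snoc_last, Fin.tail, Fin.succ_last, Fin.snoc_last]
  · rw [Fin.snoc_castSucc, Fin.tail, Fin.succ_castSucc, Fin.snoc_castSucc]
    rfl

theorem ofFn_joinString {d n : ℕ} (future past : Fin n → Fin d) (a : Fin d) :
    List.ofFn (joinString future past a)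
      = (List.ofFn past).reverse ++ a :: List.ofFn future := by
  apply List.ext_getElem
  · simp; omega
  · intro i h1 h2
    rw [List.getElem_ofFn]
    simp only [joinString]
    split_ifs with h h'
    · rw [List.getElem_append_left (by simpa using h)]
      simp
    · rw [List.getElem_append_right (by simp; omega)]
      simp [h']
    · rw [List.getElem_append_right (by simp; omega), List.getElem_cons]
      rw [dif_neg (by simp; omega)]
      simp

namespace QuasiHMM

variable {d k : ℕ} (q : QuasiHMM d k)

/-- The row vector `uᵀ T_{w_n} ⋯ T_{w_1}`. -/
def futureVec (n : ℕ) (w : Fin n → Fin d) : Fin k → ℝ :=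
  (List.ofFn w).foldr (fun a r => vecMul r (q.T a)) q.u

/-- The column vector `T_{w_1} ⋯ T_{w_n} v`. -/
def pastVec (n : ℕ) (w : Fin n → Fin d) : Fin k → ℝ :=
  (List.ofFn w).foldr (fun a x => (q.T a).mulVec x) q.v

/-- The matrix with rows `uᵀ T_{w_n} ⋯ T_{w_1}`. -/
def future (n : ℕ) : Matrix (Fin n → Fin d) (Fin k) ℝ := Matrix.of (q.futureVec n)

/-- The matrix with rows `(T_{w_1} ⋯ T_{w_n} v)ᵀ`. -/
def past (n : ℕ) : Matrix (Fin n → Fin d) (Fin k) ℝ := Matrix.of (q.pastVec n)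

theorem futureVec_zero (w : Fin 0 → Fin d) : q.futureVec 0 w = q.u := rfl

theorem pastVec_zero (w : Fin 0 → Fin d) : q.pastVec 0 w = q.v := rfl

theorem futureVec_succ {n : ℕ} (w : Fin (n + 1) → Fin d) :
    q.futureVec (n + 1) w = vecMul (q.futureVec n (Fin.tail w)) (q.T (w 0)) := by
  simp only [futureVec, List.ofFn_succ, List.foldr_cons]
  rfl

theorem pastVec_succ {n : ℕ} (w : Fin (n + 1) → Fin d) :
    q.pastVec (n + 1) w = (q.T (w 0)).mulVec (q.pastVec n (Fin.tail w)) := by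
  simp only [pastVec, List.ofFn_succ, List.foldr_cons]
  rfl

theorem future_mul_apply {c : Type*} {n : ℕ} (X : Matrix (Fin k) c ℝ) (w : Fin n → Fin d)
    (i : c) : (q.future n * X) w i = vecMul (q.futureVec n w) X i := rfl

theorem dotProduct_foldl (l : List (Fin d)) (x : Fin k → ℝ) :
    q.u ⬝ᵥ l.foldl (fun w a => (q.T a).mulVec w) x
      = l.foldr (fun a r => vecMul r (q.T a)) q.u ⬝ᵥ x := by
  induction l generalizing x with
  | nil => rfl
  | cons a l ih => rw [List.foldl_cons, ih, List.foldr_cons, dotProduct_mulVec]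

theorem prob_joinString {n : ℕ} (f p : Fin n → Fin d) (a : Fin d) :
    q.prob (joinString f p a) = (q.future n * q.T a * (q.past n).transpose) f p := by
  rw [prob, ofFn_joinString, List.foldl_append, List.foldl_cons, dotProduct_foldl,
    List.foldl_reverse, Matrix.mul_assoc, future_mul_apply, ← vecMul_vecMul, dotProduct_mulVec]
  rfl

theorem sum_futureVec (n : ℕ) : ∑ w, q.futureVec n w = q.u := by
  induction n with
  | zero => simp [futureVec_zero]
  | succ n ih =>
    rw [sum_fin_cons]
    simp_rw [futureVec_succ, Fin.tail_cons, Fin.cons_zero, ← sum_vecMul, ih, ← vecMul_sum]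
    exact q.u_norm

theorem sum_pastVec (n : ℕ) : ∑ w, q.pastVec n w = q.v := by
  induction n with
  | zero => simp [pastVec_zero]
  | succ n ih =>
    rw [sum_fin_cons]
    simp_rw [pastVec_succ, Fin.tail_cons, Fin.cons_zero, ← mulVec_sum, ih, ← sum_mulVec]
    exact q.v_norm

theorem sum_futureVec_snoc (n : ℕ) (w : Fin n → Fin d) :
    ∑ a, q.futureVec (n + 1) (Fin.snoc w a) = q.futureVec n w := by
  induction n with
  | zero =>
    rw [futureVec_zero, ← q.sum_futureVec 1, sum_fin_snoc]
    simp [Subsingleton.elim w default]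
  | succ n ih =>
    rw [futureVec_succ, ← ih, sum_vecMul]
    refine Finset.sum_congr rfl fun a _ => ?_
    rw [futureVec_succ, tail_snoc, ← Fin.castSucc_zero, Fin.snoc_castSucc]

theorem sum_pastVec_snoc (n : ℕ) (w : Fin n → Fin d) :
    ∑ a, q.pastVec (n + 1) (Fin.snoc w a) = q.pastVec n w := by
  induction n with
  | zero =>
    rw [pastVec_zero, ← q.sum_pastVec 1, sum_fin_snoc]
    simp [Subsingleton.elim w default]
  | succ n ih =>
    rw [pastVec_succ, ← ih, mulVec_sum]
    refine Finset.sum_congr rfl fun a _ => ?_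
    rw [pastVec_succ, tail_snoc, ← Fin.castSucc_zero, Fin.snoc_castSucc]

theorem marginalize_future (n : ℕ) : marginalize (q.future (n + 1)) = q.future n := by
  ext w i
  change ∑ a, q.futureVec (n + 1) (Fin.snoc w a) i = q.futureVec n w i
  rw [← q.sum_futureVec_snoc n w, Finset.sum_apply]

theorem marginalize_past (n : ℕ) : marginalize (q.past (n + 1)) = q.past n := by
  ext w i
  change ∑ a, q.pastVec (n + 1) (Fin.snoc w a) i = q.pastVec n w i
  rw [← q.sum_pastVec_snoc n w, Finset.sum_apply]

end QuasiHMM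

theorem marginalize_mul {d k n : ℕ} (A : Matrix (Fin (n + 1) → Fin d) (Fin k) ℝ)
    (X : Matrix (Fin k) (Fin k) ℝ) : marginalize (A * X) = marginalize A * X := by
  ext w i
  simp only [marginalize, of_apply, mul_apply, Finset.sum_mul]
  exact Finset.sum_comm

theorem rank_of_rank_marginalize {d k n : ℕ} {A : Matrix (Fin (n + 1) → Fin d) (Fin k) ℝ}
    (h : (marginalize A).rank = k) : A.rank = k := by
  apply rank_eq_of_leftInverse
    (L := Matrix.of fun i w => pinv (marginalize A) i (Fin.init w))
  rw [← pinv_mul h]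
  ext i j
  rw [mul_apply, sum_fin_snoc, mul_apply]
  simp only [of_apply, Fin.init_snoc, marginalize, Finset.mul_sum]

namespace HMM

variable {d k : ℕ} (θ : HMM d k)

theorem prob_zero (p : Fin k → ℝ) (l : Fin 1 → Fin d) :
    θ.prob p l = ∑ i, p i * θ.O (l 0) i := by
  rw [prob, ← (Equiv.funUnique (Fin 1) (Fin k)).symm.sum_comp]
  simp

theorem prob_succ {L : ℕ} (p : Fin k → ℝ) (l : Fin (L + 2) → Fin d) :
    θ.prob p l = θ.prob ((θ.Q * diagonal (θ.O (l 0))).mulVec p) (Fin.tail l) := by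
  rw [prob, prob, sum_fin_cons, Finset.sum_comm]
  refine Finset.sum_congr rfl fun x _ => ?_
  simp only [mulVec, dotProduct, mul_diagonal, Finset.sum_mul]
  refine Finset.sum_congr rfl fun i _ => ?_
  rw [Fin.prod_univ_succ, Fin.prod_univ_succ (n := L + 1)]
  simp only [Fin.cons_zero, Fin.cons_succ, Fin.castSucc_zero, ← Fin.succ_castSucc, Fin.tail]
  ring

theorem vecMul_Q : vecMul (fun _ => 1) θ.Q = fun _ => 1 := by
  ext j
  simpa [vecMul, dotProduct] using θ.Q_sum j

theorem dotProduct_foldl_eq_prob {L : ℕ} (p : Fin k → ℝ) (l : Fin (L + 1) → Fin d) :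
    (fun _ => 1) ⬝ᵥ ((List.ofFn l).foldl
      (fun w a => (θ.Q * diagonal (θ.O a)).mulVec w) p) = θ.prob p l := by
  induction L generalizing p with
  | zero =>
    rw [prob_zero]
    simp only [List.ofFn_succ, List.ofFn_zero, List.foldl_cons, List.foldl_nil]
    rw [dotProduct_mulVec, ← vecMul_vecMul, vecMul_Q]
    simp only [dotProduct, vecMul_diagonal]
    exact Finset.sum_congr rfl fun i _ => by ring
  | succ L ih =>
    rw [prob_succ, ← ih, List.ofFn_succ, List.foldl_cons]
    rfl

theorem toQuasi_prob {p : Fin k → ℝ} (hp : θ.IsStationary p) {L : ℕ} (l : Fin (L + 1) → Fin d) :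
    (θ.toQuasi p hp).prob l = θ.prob p l :=
  θ.dotProduct_foldl_eq_prob p l

theorem future_mul_Q {p : Fin k → ℝ} (hp : θ.IsStationary p) (n : ℕ) :
    (θ.toQuasi p hp).future n * θ.Q = θ.factorA n := by
  induction n with
  | zero =>
    ext w i
    rw [QuasiHMM.future_mul_apply, QuasiHMM.futureVec_zero]
    exact congrFun θ.vecMul_Q i
  | succ n ih =>
    rw [factorA, condMatrix, ← factorA, ← ih]
    congr 1
    ext w i
    rw [QuasiHMM.future, of_apply, QuasiHMM.futureVec_succ, toQuasi, ← vecMul_vecMul,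
      vecMul_diagonal, mul_comm]
    rfl

theorem past_eq {p : Fin k → ℝ} (hp : θ.IsStationary p) (hpos : ∀ i, 0 < p i) (n : ℕ) :
    (θ.toQuasi p hp).past n = θ.factorB p n * diagonal p := by
  have hdet : IsUnit (diagonal p).det := by
    rw [det_diagonal]
    exact (Finset.prod_ne_zero_iff.mpr fun i _ => (hpos i).ne').isUnit
  induction n with
  | zero =>
    ext w i
    rw [QuasiHMM.past, of_apply, QuasiHMM.pastVec_zero, mul_diagonal]
    simp [factorB, condMatrix, toQuasi]
  | succ n ih =>
    rw [factorB, condMatrix, ← factorB, Matrix.mul_assoc, backward, Matrix.mul_assoc,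
      nonsing_inv_mul _ hdet, Matrix.mul_one]
    ext w i
    have hrow : (θ.toQuasi p hp).pastVec n (Fin.tail w)
        = fun j => θ.factorB p n (Fin.tail w) j * p j := by
      ext j
      rw [← mul_diagonal, ← ih]
      rfl
    rw [QuasiHMM.past, of_apply, QuasiHMM.pastVec_succ, hrow, mul_apply]
    simp only [toQuasi, mulVec, dotProduct, mul_diagonal, diagonal_mul, transpose_apply,
      khatriRaoCons, of_apply]
    exact Finset.sum_congr rfl fun j _ => by ring

end HMM

theorem Matrix.perm_mul_apply {c : Type*} {k : ℕ} {S : Matrix (Fin k) (Fin k) ℝ}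
    {σ : Fin k ≃ Fin k} (h : ∀ i j, i ≠ σ j → S i j = 0) (X : Matrix (Fin k) c ℝ) (i : Fin k)
    (j : c) : (S * X) (σ i) j = S (σ i) i * X i j := by
  rw [mul_apply, Finset.sum_eq_single i]
  · intro b _ hb
    rw [h _ b fun e => hb (σ.injective e).symm, zero_mul]
  · simp

/-- If `A X Bᵀ = A' X' B'ᵀ` with `A`, `B` of full column rank and `X` invertible, then `A'`, `B'`
have at least as many columns. -/
theorem Matrix.le_of_factorization {m₁ m₂ : Type*} [Fintype m₁] [Fintype m₂] {k k' : ℕ}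
    {A : Matrix m₁ (Fin k) ℝ} {B : Matrix m₂ (Fin k) ℝ} {A' : Matrix m₁ (Fin k') ℝ}
    {B' : Matrix m₂ (Fin k') ℝ} {X : Matrix (Fin k) (Fin k) ℝ} {X' : Matrix (Fin k') (Fin k') ℝ}
    (hA : A.rank = k) (hB : B.rank = k) (hX : IsUnit X.det)
    (h : A * X * B.transpose = A' * X' * B'.transpose) :
    X = pinv A * A' * X' * (pinv B * B').transpose ∧ k ≤ k' := by
  have e : X = pinv A * A' * X' * (pinv B * B').transpose := by
    have hB' : B.transpose * (pinv B).transpose = 1 := by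
      rw [← transpose_mul, pinv_mul hB, transpose_one]
    calc X = (pinv A * A) * X * (B.transpose * (pinv B).transpose) := by
          rw [pinv_mul hA, hB', Matrix.one_mul, Matrix.mul_one]
      _ = pinv A * (A * X * B.transpose) * (pinv B).transpose := by
          simp only [Matrix.mul_assoc]
      _ = _ := by rw [h, transpose_mul]; simp only [Matrix.mul_assoc]
  refine ⟨e, ?_⟩
  have hr : X.rank = k := by
    simpa using rank_of_isUnit X ((isUnit_iff_isUnit_det X).mpr hX)
  rw [← hr, e, Matrix.mul_assoc]
  exact (rank_mul_le_left _ _).trans ((rank_le_card_width _).trans_eq (Fintype.card_fin k'))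

/-- If `A X Bᵀ = A' X' B'ᵀ` with `A`, `B` of full column rank and `X` invertible, and `A'`, `B'`
have as many columns, then the factors differ by changes of basis. -/
theorem Matrix.exists_of_factorization {m₁ m₂ : Type*} [Fintype m₁] [Fintype m₂] {k : ℕ}
    {A : Matrix m₁ (Fin k) ℝ} {B : Matrix m₂ (Fin k) ℝ} {A' : Matrix m₁ (Fin k) ℝ}
    {B' : Matrix m₂ (Fin k) ℝ} {X X' : Matrix (Fin k) (Fin k) ℝ}
    (hA : A.rank = k) (hB : B.rank = k) (hX : IsUnit X.det)
    (h : A * X * B.transpose = A' * X' * B'.transpose) :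
    ∃ S W : Matrix (Fin k) (Fin k) ℝ, IsUnit S.det ∧ IsUnit W.det ∧ IsUnit X'.det ∧
      A' = A * S ∧ B' = B * W ∧ X = S * X' * W.transpose := by
  obtain ⟨e, -⟩ := le_of_factorization hA hB hX h
  set S := pinv A * A' with hS
  set W := pinv B * B' with hW
  have hu := hX
  rw [e, det_mul, det_mul, det_transpose, IsUnit.mul_iff, IsUnit.mul_iff] at hu
  obtain ⟨⟨hSu, hX'u⟩, hWu⟩ := hu
  have hWt : IsUnit W.transpose.det := by rwa [det_transpose]
  refine ⟨S, W, hSu, hWu, hX'u, ?_, ?_, e⟩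
  · have h1 : A * X = A' * (X' * W.transpose) := by
      have h2 := congrArg (· * (pinv B).transpose) h
      simp only [Matrix.mul_assoc] at h2
      rw [← transpose_mul, ← transpose_mul, pinv_mul hB, transpose_one, Matrix.mul_one] at h2
      exact h2
    have hY : IsUnit (X' * W.transpose).det := by
      rw [det_mul]
      exact hX'u.mul hWt
    rw [e, Matrix.mul_assoc S, ← Matrix.mul_assoc A] at h1
    have h3 := congrArg (· * (X' * W.transpose)⁻¹) h1
    simp only [mul_nonsing_inv_cancel_right _ _ hY] at h3
    exact h3.symm
  · have h1 : X * B.transpose = (S * X') * B'.transpose := by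
      have h2 := congrArg (pinv A * ·) h
      simp only [← Matrix.mul_assoc] at h2
      rw [pinv_mul hA, Matrix.one_mul] at h2
      exact h2
    have hY : IsUnit (S * X').det := by
      rw [det_mul]
      exact hSu.mul hX'u
    rw [e, Matrix.mul_assoc _ W.transpose] at h1
    have h3 := congrArg ((S * X')⁻¹ * ·) h1
    simp only [nonsing_inv_mul_cancel_left _ _ hY] at h3
    rw [← transpose_mul] at h3
    exact (transpose_injective h3).symm

namespace QuasiHMM

variable {d k k' n : ℕ} {q : QuasiHMM d k} {q' : QuasiHMM d k'}

theorem future_mul_T_mul_past_eq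
    (h : ∀ l : Fin (2 * n + 1) → Fin d, q'.prob l = q.prob l) (a : Fin d) :
    q.future n * q.T a * (q.past n).transpose
      = q'.future n * q'.T a * (q'.past n).transpose := by
  ext w w'
  rw [← prob_joinString, ← prob_joinString, h]

theorem future_mul_sum_mul_past_eq
    (h : ∀ l : Fin (2 * n + 1) → Fin d, q'.prob l = q.prob l) :
    q.future n * (∑ a, q.T a) * (q.past n).transpose
      = q'.future n * (∑ a, q'.T a) * (q'.past n).transpose := by
  simp only [Matrix.mul_sum, Matrix.sum_mul, future_mul_T_mul_past_eq h]

theorem le_of_prob_eq (hf : (q.future n).rank = k) (hb : (q.past n).rank = k)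
    (hT : IsUnit (∑ a, q.T a).det)
    (h : ∀ l : Fin (2 * n + 1) → Fin d, q'.prob l = q.prob l) : k ≤ k' :=
  (le_of_factorization hf hb hT (future_mul_sum_mul_past_eq h)).2

theorem equivalent_of_prob_eq {q' : QuasiHMM d k} {n : ℕ} (hf : (q.future n).rank = k)
    (hb : (q.past (n + 1)).rank = k) (hT : IsUnit (∑ a, q.T a).det)
    (h : ∀ l : Fin (2 * (n + 1) + 1) → Fin d, q'.prob l = q.prob l) : q.Equivalent q' := by
  have hf' : (q.future (n + 1)).rank = k :=
    rank_of_rank_marginalize (by rw [marginalize_future, hf])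
  obtain ⟨S, W, hS, hW, -, hF, -, -⟩ :=
    exists_of_factorization hf' hb hT (future_mul_sum_mul_past_eq h)
  have hFv : ∀ w, q'.futureVec (n + 1) w = vecMul (q.futureVec (n + 1) w) S :=
    fun w => congrFun hF w
  have hFn : q'.future n = q.future n * S := by
    rw [← marginalize_future, hF, marginalize_mul, marginalize_future]
  have hFnv : ∀ w, q'.futureVec n w = vecMul (q.futureVec n w) S := fun w => congrFun hFn w
  have hTS : ∀ a, S * q'.T a = q.T a * S := by
    intro a
    apply mul_left_cancel_of_rank hf
    ext w i
    have e1 := q'.futureVec_succ (Fin.cons a w : Fin (n + 1) → Fin d)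
    rw [hFv, q.futureVec_succ, Fin.tail_cons, Fin.cons_zero, hFnv] at e1
    rw [future_mul_apply, future_mul_apply, ← vecMul_vecMul, ← vecMul_vecMul, e1]
  have hSinv : ∀ {c : Type} (X : Matrix (Fin k) c ℝ), S⁻¹ * (S * X) = X := fun X => by
    rw [← Matrix.mul_assoc, nonsing_inv_mul _ hS, Matrix.one_mul]
  have hP : (q.past (n + 1)).transpose = S * (q'.past (n + 1)).transpose := by
    have e := future_mul_sum_mul_past_eq h
    have hsum : S * ∑ a, q'.T a = (∑ a, q.T a) * S := by
      simp only [Finset.mul_sum, Finset.sum_mul, hTS]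
    rw [hF, Matrix.mul_assoc, Matrix.mul_assoc, Matrix.mul_assoc, ← Matrix.mul_assoc S, hsum,
      Matrix.mul_assoc] at e
    have e2 := mul_left_cancel_of_rank hf' e
    have e3 := congrArg ((∑ a, q.T a)⁻¹ * ·) e2
    simpa only [← Matrix.mul_assoc (_⁻¹), nonsing_inv_mul _ hT, Matrix.one_mul] using e3
  have hPv : ∀ w, q.pastVec (n + 1) w = S.mulVec (q'.pastVec (n + 1) w) := by
    intro w
    ext i
    exact congrFun (congrFun hP i) w
  have hv : q.v = S.mulVec q'.v := by
    rw [← q.sum_pastVec (n + 1), ← q'.sum_pastVec (n + 1), mulVec_sum]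
    exact Finset.sum_congr rfl fun w _ => hPv w
  refine ⟨S, hS, ?_, ?_, ?_⟩
  · rw [mulVec_transpose, ← q.sum_futureVec (n + 1), ← q'.sum_futureVec (n + 1), sum_vecMul]
    exact Finset.sum_congr rfl fun w _ => hFv w
  · rw [hv, mulVec_mulVec, nonsing_inv_mul _ hS, one_mulVec]
  · intro a
    rw [Matrix.mul_assoc, ← hTS, hSinv]

end QuasiHMM

namespace HMM

variable {d k : ℕ} {θ : HMM d k}

theorem sum_toQuasi_T {p : Fin k → ℝ} (hp : θ.IsStationary p) :
    ∑ a, (θ.toQuasi p hp).T a = θ.Q := θ.sum_quasi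

theorem isUnit_det_Q {n : ℕ} (hA : (θ.factorA (n + 1)).rank = k) : IsUnit θ.Q.det := by
  apply isUnit_det_of_rank_eq
  apply le_antisymm
  · simpa using θ.Q.rank_le_card_width
  · have := rank_mul_le_right (khatriRaoCons θ.O (condMatrix θ.Q θ.O n)) θ.Q
    rwa [← condMatrix, ← factorA, hA] at this

theorem rank_future {p : Fin k → ℝ} (hp : θ.IsStationary p) {n : ℕ}
    (hA : (θ.factorA n).rank = k) : ((θ.toQuasi p hp).future n).rank = k := by
  apply rank_eq_of_rank_mul (X := θ.Q)
  rw [future_mul_Q, hA]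

theorem isUnit_det_diagonal {p : Fin k → ℝ} (hpos : ∀ i, 0 < p i) :
    IsUnit (diagonal p).det := by
  rw [det_diagonal]
  exact (Finset.prod_ne_zero_iff.mpr fun i _ => (hpos i).ne').isUnit

theorem rank_past {p : Fin k → ℝ} (hp : θ.IsStationary p) (hpos : ∀ i, 0 < p i) (n : ℕ) :
    ((θ.toQuasi p hp).past n).rank = (θ.factorB p n).rank := by
  rw [past_eq _ _ hpos, rank_mul_eq_left_of_isUnit_det _ _ (isUnit_det_diagonal hpos)]

/-- Two HMMs with equivalent quasi-HMMs agree up to a permutation of the states. -/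
theorem exists_perm_of_equivalent {θ' : HMM d k} {p p' : Fin k → ℝ} (hp : θ.IsStationary p)
    (hp' : θ'.IsStationary p') (hQ : IsUnit θ.Q.det)
    (hO : ∀ i i', (∀ a, θ.O a i = θ.O a i') → i = i')
    (h : (θ.toQuasi p hp).Equivalent (θ'.toQuasi p' hp')) :
    ∃ σ : Fin k ≃ Fin k,
      θ'.Q = θ.Q.submatrix σ σ ∧ θ'.O = θ.O.submatrix id σ ∧ p' = p ∘ σ := by
  obtain ⟨S, hS, hu, hv, hT⟩ := h
  have hT' : ∀ a, S * (θ'.toQuasi p' hp').T a = (θ.toQuasi p hp).T a * S := fun a => by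
    rw [hT, ← Matrix.mul_assoc, ← Matrix.mul_assoc, mul_nonsing_inv _ hS, Matrix.one_mul]
  have hQS : S * θ'.Q = θ.Q * S := by
    rw [← sum_toQuasi_T hp, ← sum_toQuasi_T hp', Finset.mul_sum, Finset.sum_mul]
    exact Finset.sum_congr rfl fun a _ => hT' a
  have hint : ∀ a, S * diagonal (θ'.O a) = diagonal (θ.O a) * S := by
    intro a
    have e := hT' a
    simp only [toQuasi] at e
    rw [← Matrix.mul_assoc, hQS, Matrix.mul_assoc, Matrix.mul_assoc] at e
    have e3 := congrArg (θ.Q⁻¹ * ·) e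
    simpa only [← Matrix.mul_assoc (_⁻¹), nonsing_inv_mul _ hQ, Matrix.one_mul] using e3
  obtain ⟨σ, h0, -, hσ⟩ := exists_perm_of_intertwine hS hO hint
  have h1 : ∀ j, S (σ j) j = 1 := by
    intro j
    have := congrFun hu j
    simp only [toQuasi, mulVec, dotProduct, transpose_apply, mul_one] at this
    rw [this, Finset.sum_eq_single (σ j)]
    · exact fun b _ hb => h0 b j hb
    · simp
  refine ⟨σ, ?_, ?_, ?_⟩
  · ext i j
    have := congrFun (congrFun hQS (σ i)) j
    rwa [perm_mul_apply h0, mul_apply_of_perm h0, h1, h1, one_mul, mul_one] at this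
  · ext a j
    exact hσ a j
  · ext i
    have hv' : S.mulVec p' = p := by
      change p' = S⁻¹.mulVec p at hv
      rw [hv, mulVec_mulVec, mul_nonsing_inv _ hS, one_mulVec]
    rw [Function.comp_apply, ← hv', mulVec, dotProduct, Finset.sum_eq_single i, h1, one_mul]
    · intro b _ hb
      rw [h0 _ b fun e => hb (σ.injective e).symm, zero_mul]
    · simp

theorem tensorM_eq {p : Fin k → ℝ} (hp : θ.IsStationary p) (hpos : ∀ i, 0 < p i) (n : ℕ) :
    tensorM (fun l : Fin (2 * n + 1) → Fin d => θ.prob p l)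
      = tensorOf (θ.factorA n) (θ.factorB p n) (θ.factorC p) := by
  funext f w a
  change θ.prob p (joinString f w a) = _
  rw [← θ.toQuasi_prob hp, QuasiHMM.prob_joinString, past_eq _ _ hpos]
  change ((θ.toQuasi p hp).future n * (θ.Q * diagonal (θ.O a)) *
    (θ.factorB p n * diagonal p).transpose) f w = _
  rw [← Matrix.mul_assoc, future_mul_Q, transpose_mul, mul_apply]
  simp only [tensorOf, factorC, mul_diagonal, diagonal_transpose, diagonal_mul, transpose_apply]
  exact Finset.sum_congr rfl fun i _ => by ring

end HMM

theorem contract_single_tensorOf {m₁ m₂ m₃ : Type*} {k : ℕ} (A : Matrix m₁ (Fin k) ℝ)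
    (B : Matrix m₂ (Fin k) ℝ) (C : Matrix m₃ (Fin k) ℝ) (a : m₃) :
    A * diagonal (C a) * B.transpose = Matrix.of fun i j => tensorOf A B C i j a := by
  ext i j
  rw [mul_apply]
  simp only [mul_diagonal, transpose_apply, tensorOf, of_apply]
  exact Finset.sum_congr rfl fun i _ => by ring

theorem sum_diagonal_apply {m : Type*} [Fintype m] {k : ℕ} (C : Matrix m (Fin k) ℝ) :
    ∑ a, diagonal (C a) = diagonal fun i => ∑ a, C a i := by
  ext i j
  rw [Matrix.sum_apply]
  by_cases h : i = j
  · subst h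
    simp
  · simp [diagonal, h]

/-- Uniqueness of the rank decomposition of a tensor with two factors of full column rank, the
third factor having pairwise nonproportional columns with nonzero sums. -/
theorem tensorOf_unique {m₁ m₂ m₃ : Type*} [Fintype m₁] [Fintype m₂] [Fintype m₃] {k k' : ℕ}
    {A : Matrix m₁ (Fin k) ℝ} {B : Matrix m₂ (Fin k) ℝ} {O : Matrix m₃ (Fin k) ℝ}
    {p : Fin k → ℝ} {A' : Matrix m₁ (Fin k') ℝ} {B' : Matrix m₂ (Fin k') ℝ}
    {C' : Matrix m₃ (Fin k') ℝ} (hA : A.rank = k) (hB : B.rank = k)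
    (hsum : ∀ i, ∑ a, O a i = 1) (hO : ∀ i i', (∀ a, O a i = O a i') → i = i')
    (hp : ∀ i, p i ≠ 0) (h : tensorOf A B (O * diagonal p) = tensorOf A' B' C') :
    k ≤ k' ∧ (k' = k → ∃ (σ : Fin k' ≃ Fin k) (a b c : Fin k' → ℝ), ∀ i,
      a i * b i * c i = 1 ∧ (∀ w, A' w i = a i * A w (σ i)) ∧
      (∀ w, B' w i = b i * B w (σ i)) ∧
      (∀ y, C' y i = c i * (O * diagonal p) y (σ i))) := by
  set C := O * diagonal p with hC
  have hslice : ∀ a, A * diagonal (C a) * B.transpose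
      = A' * diagonal (C' a) * B'.transpose := fun a => by
    rw [contract_single_tensorOf, contract_single_tensorOf, h]
  have hCsum : ∑ a, diagonal (C a) = diagonal p := by
    rw [sum_diagonal_apply]
    congr 1
    ext i
    simp_rw [hC, mul_diagonal, ← Finset.sum_mul, hsum, one_mul]
  have htot : A * diagonal p * B.transpose
      = A' * (diagonal fun i => ∑ a, C' a i) * B'.transpose := by
    rw [← hCsum, ← sum_diagonal_apply]
    simp only [Matrix.mul_sum, Matrix.sum_mul, hslice]
  have hpu : IsUnit (diagonal p).det := by
    rw [det_diagonal]
    exact (Finset.prod_ne_zero_iff.mpr fun i _ => hp i).isUnit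
  refine ⟨(le_of_factorization hA hB hpu htot).2, ?_⟩
  rintro rfl
  set e := fun i => ∑ a, C' a i with he
  obtain ⟨S, W, hS, hW, hE, hAS, hBW, hX⟩ := exists_of_factorization hA hB hpu htot
  have he0 : ∀ i, e i ≠ 0 := by
    rw [det_diagonal] at hE
    exact fun i => Finset.prod_ne_zero_iff.mp hE.ne_zero i (Finset.mem_univ i)
  have hCa : ∀ a, diagonal (C a) = S * diagonal (C' a) * W.transpose := by
    intro a
    have e1 := hslice a
    rw [hAS, hBW, transpose_mul] at e1
    apply mul_left_cancel_of_rank hA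
    apply mul_right_cancel_of_rank hB
    rw [e1]
    simp only [Matrix.mul_assoc]
  have hint : ∀ a, S * diagonal (fun j => C' a j / e j) = diagonal (O a) * S := by
    intro a
    have e1 : diagonal (O a) * S * diagonal e * W.transpose
        = S * diagonal (C' a) * W.transpose := by
      rw [← hCa, Matrix.mul_assoc, Matrix.mul_assoc, ← Matrix.mul_assoc S, ← hX,
        diagonal_mul_diagonal]
      congr 1
      ext i
      rw [hC, mul_diagonal]
    have hWr : W.rank = k' := by
      simpa using rank_of_isUnit W ((isUnit_iff_isUnit_det W).mpr hW)
    have e2 := mul_right_cancel_of_rank hWr e1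
    ext i j
    have e3 := congrFun (congrFun e2 i) j
    rw [mul_diagonal, mul_diagonal] at e3
    rw [mul_diagonal, ← mul_div_assoc, ← e3, mul_div_assoc, div_self (he0 j), mul_one]
  obtain ⟨σ, h0, hne, hσ⟩ := exists_perm_of_intertwine hS hO hint
  have hWe : ∀ i j, diagonal p (σ j) i = S (σ j) j * (e j * W i j) := by
    intro i j
    rw [hX, Matrix.mul_assoc, perm_mul_apply h0, diagonal_mul, transpose_apply]
  have hW0 : ∀ i j, i ≠ σ j → W i j = 0 := by
    intro i j hij
    have := hWe i j
    rw [diagonal_apply_ne _ hij.symm] at this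
    simpa [hne j, he0 j] using this.symm
  refine ⟨σ, fun j => S (σ j) j, fun j => W (σ j) j, fun j => e j / p (σ j), fun j => ?_⟩
  have hWj := hWe (σ j) j
  rw [diagonal_apply_eq] at hWj
  refine ⟨?_, ?_, ?_, ?_⟩
  · rw [← mul_div_assoc, div_eq_one_iff_eq (hp _), hWj]
    ring
  · intro w
    rw [hAS, mul_apply_of_perm h0, mul_comm]
  · intro w
    rw [hBW, mul_apply_of_perm hW0, mul_comm]
  · intro y
    have := hσ y j
    rw [div_eq_iff (he0 j)] at this
    rw [this, hC, mul_diagonal]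
    field_simp [hp (σ j)]

theorem Matrix.rank_pinv_transpose {m : Type*} [Fintype m] {k : ℕ} {A : Matrix m (Fin k) ℝ}
    (hA : A.rank = k) : (pinv A).transpose.rank = k :=
  rank_eq_of_leftInverse (L := A.transpose)
    (by rw [← transpose_mul, pinv_mul hA, transpose_one])

/-- An eigen-decomposition `A Λ A†` with distinct nonzero eigenvalues and columns of `A` summing to
one is unique up to a permutation. -/
theorem exists_perm_of_eigen_eq {m : Type*} [Fintype m] {k k' : ℕ} {A : Matrix m (Fin k) ℝ}
    {A' : Matrix m (Fin k') ℝ} {l : Fin k → ℝ} {l' : Fin k' → ℝ} (hA : A.rank = k)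
    (hA' : A'.rank = k') (hl : ∀ i, l i ≠ 0) (hl' : ∀ i, l' i ≠ 0)
    (hinj : Function.Injective l) (hs : ∀ i, ∑ w, A w i = 1) (hs' : ∀ i, ∑ w, A' w i = 1)
    (h : A * diagonal l * pinv A = A' * diagonal l' * pinv A') :
    ∃ σ : Fin k' ≃ Fin k, A' = A.submatrix id σ ∧ ∀ j, l' j = l (σ j) := by
  have hu : ∀ {r : ℕ} {f : Fin r → ℝ}, (∀ i, f i ≠ 0) → IsUnit (diagonal f).det := by
    intro r f hf
    rw [det_diagonal]
    exact (Finset.prod_ne_zero_iff.mpr fun i _ => hf i).isUnit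
  have h' : A * diagonal l * (pinv A).transpose.transpose
      = A' * diagonal l' * (pinv A').transpose.transpose := by
    simpa only [transpose_transpose] using h
  have hkk : k = k' := le_antisymm
    (le_of_factorization hA (rank_pinv_transpose hA) (hu hl) h').2
    (le_of_factorization hA' (rank_pinv_transpose hA') (hu hl') h'.symm).2
  subst hkk
  obtain ⟨S, W, hS, -, -, hAS, hBW, hX⟩ :=
    exists_of_factorization hA (rank_pinv_transpose hA) (hu hl) h'
  have hWS : W.transpose * S = 1 := by
    rw [← pinv_mul hA']
    conv_rhs => rw [← transpose_transpose (pinv A'), hBW, hAS]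
    rw [transpose_mul, transpose_transpose, Matrix.mul_assoc, ← Matrix.mul_assoc (pinv A),
      pinv_mul hA, Matrix.one_mul]
  obtain ⟨σ, h0, -, hσ⟩ := exists_perm_of_intertwine (ι := Unit) (g := fun _ => l')
    (o := fun _ => l) hS (fun i i' hi => hinj (hi ())) fun _ => by
      rw [hX, Matrix.mul_assoc _ W.transpose, hWS, Matrix.mul_one]
  exact ⟨σ, (eq_submatrix_of_perm h0 hs hs' hAS).1, hσ ()⟩

theorem rank_khatriRao {m₁ m₂ : Type*} [Fintype m₁] [Fintype m₂] {k : ℕ}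
    {A : Matrix m₁ (Fin k) ℝ} {B : Matrix m₂ (Fin k) ℝ} (hA : A.rank = k) (hB : B.rank = k) :
    (khatriRao A B).rank = k := by
  apply rank_eq_of_leftInverse (L := Matrix.of fun i r => pinv A i r.1 * pinv B i r.2)
  ext i j
  have e1 := congrFun (congrFun (pinv_mul hA) i) j
  have e2 := congrFun (congrFun (pinv_mul hB) i) j
  rw [mul_apply] at e1 e2
  rw [mul_apply, Fintype.sum_prod_type]
  simp only [of_apply, khatriRao]
  calc ∑ x, ∑ y, pinv A i x * pinv B i y * (A x j * B y j)
      = (∑ x, pinv A i x * A x j) * ∑ y, pinv B i y * B y j := by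
        rw [Finset.sum_mul_sum]
        exact Finset.sum_congr rfl fun x _ => Finset.sum_congr rfl fun y _ => by ring
    _ = (1 : Matrix (Fin k) (Fin k) ℝ) i j := by
        rw [e1, e2, one_apply]
        split_ifs <;> simp

theorem matricize₃_tensorOf {m₁ m₂ m₃ : Type*} {k : ℕ} (A : Matrix m₁ (Fin k) ℝ)
    (B : Matrix m₂ (Fin k) ℝ) (C : Matrix m₃ (Fin k) ℝ) :
    matricize₃ (tensorOf A B C) = C * (khatriRao A B).transpose := by
  ext a j
  rw [mul_apply]
  simp only [matricize₃, tensorOf, khatriRao, of_apply, transpose_apply]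
  exact Finset.sum_congr rfl fun i _ => by ring

theorem contract_tensorOf {m₁ m₂ : Type*} {d k : ℕ} (A : Matrix m₁ (Fin k) ℝ)
    (B : Matrix m₂ (Fin k) ℝ) (C : Matrix (Fin d) (Fin k) ℝ) (v : EuclideanSpace ℝ (Fin d)) :
    contract (tensorOf A B C) v
      = A * diagonal (fun i => ∑ a, C a i * v a) * B.transpose := by
  ext j₁ j₂
  rw [mul_apply]
  simp only [contract, tensorOf, of_apply, mul_diagonal, transpose_apply, Finset.sum_mul,
    Finset.mul_sum]
  rw [Finset.sum_comm]
  exact Finset.sum_congr rfl fun i _ => Finset.sum_congr rfl fun a _ => by ring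

theorem transpose_mul_diagonal_mul {m₁ m₂ : Type*} {k : ℕ} (A : Matrix m₁ (Fin k) ℝ)
    (B : Matrix m₂ (Fin k) ℝ) (x : Fin k → ℝ) :
    (A * diagonal x * B.transpose).transpose = B * diagonal x * A.transpose := by
  simp only [transpose_mul, transpose_transpose, diagonal_transpose, Matrix.mul_assoc]

section

variable {m : Type*} [Fintype m] {d k : ℕ} {A B : Matrix m (Fin k) ℝ}
  {C : Matrix (Fin d) (Fin k) ℝ} {v₁ v₂ : EuclideanSpace ℝ (Fin d)}

theorem contract_mul_pseudoInverse (hA : A.rank = k) (hB : B.rank = k) {x y : Fin k → ℝ}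
    (hy : ∀ i, y i ≠ 0) {Y : Matrix m m ℝ}
    (hY : IsPseudoInverse (A * diagonal y * B.transpose) Y) :
    A * diagonal x * B.transpose * Y = A * diagonal (fun i => x i / y i) * pinv A := by
  have hD : diagonal y * diagonal (fun i => (y i)⁻¹) = 1 := by
    rw [diagonal_mul_diagonal, ← diagonal_one]
    congr 1
    ext i
    exact mul_inv_cancel₀ (hy i)
  rw [isPseudoInverse_unique hY (isPseudoInverse_mul hA hB hD)]
  calc _ = A * (diagonal x * (B.transpose * (pinv B).transpose)
        * diagonal fun i => (y i)⁻¹) * pinv A := by simp only [Matrix.mul_assoc]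
    _ = _ := by
      rw [← transpose_mul, pinv_mul hB, transpose_one, Matrix.mul_one, diagonal_mul_diagonal]
      rfl

theorem IsPseudoInverse.transpose {m n : Type*} [Fintype m] [Fintype n] {X : Matrix m n ℝ}
    {Y : Matrix n m ℝ} (h : IsPseudoInverse X Y) : IsPseudoInverse X.transpose Y.transpose := by
  obtain ⟨h1, h2, h3, h4⟩ := h
  refine ⟨?_, ?_, ?_, ?_⟩
  · rw [← transpose_mul, ← transpose_mul, ← Matrix.mul_assoc, h1]
  · rw [← transpose_mul, ← transpose_mul, ← Matrix.mul_assoc, h2]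
  · rw [← transpose_mul, h4, h4]
  · rw [← transpose_mul, h3, h3]

theorem isDecompositionOutput_tensorOf (hA : A.rank = k) (hB : B.rank = k)
    (hsA : ∀ i, ∑ w, A w i = 1) (hsB : ∀ i, ∑ w, B w i = 1)
    (h₁ : ∀ i, ∑ a, C a i * v₁ a ≠ 0) (h₂ : ∀ i, ∑ a, C a i * v₂ a ≠ 0) :
    IsDecompositionOutput (tensorOf A B C) v₁ v₂ A B C := by
  have hex : ∀ x : Fin k → ℝ, (∀ i, x i ≠ 0) →
      ∃ Y, IsPseudoInverse (A * diagonal x * B.transpose) Y := by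
    intro x hx
    refine ⟨_, isPseudoInverse_mul hA hB (D' := diagonal fun i => (x i)⁻¹) ?_⟩
    rw [diagonal_mul_diagonal, ← diagonal_one]
    congr 1
    ext i
    exact mul_inv_cancel₀ (hx i)
  obtain ⟨Y₁, hY₁⟩ := hex _ h₁
  obtain ⟨Y₂, hY₂⟩ := hex _ h₂
  refine ⟨Y₁, Y₂, fun i => (∑ a, C a i * v₁ a) / ∑ a, C a i * v₂ a, ?_⟩
  simp only [contract_tensorOf]
  refine ⟨hY₁, hY₂, fun i => div_ne_zero (h₁ i) (h₂ i), hA, hB,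
    contract_mul_pseudoInverse hA hB h₂ hY₂, ?_, hsA, hsB, ?_⟩
  · have hT := hY₁.transpose
    rw [transpose_mul_diagonal_mul] at hT ⊢
    rw [contract_mul_pseudoInverse hB hA h₁ hT]
    simp only [inv_div]
  · rw [matricize₃_tensorOf, Matrix.mul_assoc, ← transpose_mul,
      pinv_mul (rank_khatriRao hA hB), transpose_one, Matrix.mul_one]

theorem IsDecompositionOutput.exists_perm {k' : ℕ} {A' B' : Matrix m (Fin k') ℝ}
    {C' : Matrix (Fin d) (Fin k') ℝ} (hA : A.rank = k) (hB : B.rank = k)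
    (hsA : ∀ i, ∑ w, A w i = 1) (hsB : ∀ i, ∑ w, B w i = 1)
    (h₁ : ∀ i, ∑ a, C a i * v₁ a ≠ 0) (h₂ : ∀ i, ∑ a, C a i * v₂ a ≠ 0)
    (hinj : Function.Injective fun i => (∑ a, C a i * v₁ a) / ∑ a, C a i * v₂ a)
    (h : IsDecompositionOutput (tensorOf A B C) v₁ v₂ A' B' C') :
    ∃ σ : Fin k' ≃ Fin k, A' = A.submatrix id σ ∧ C' = C.submatrix id σ := by
  obtain ⟨Y₁, Y₂, l', hY₁, hY₂, hl', hA', hB', e₁, e₂, hsA', hsB', hC'⟩ := h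
  simp only [contract_tensorOf] at hY₁ hY₂ e₁ e₂
  rw [contract_mul_pseudoInverse hA hB h₂ hY₂] at e₁
  have hT := hY₁.transpose
  rw [transpose_mul_diagonal_mul] at hT e₂
  rw [contract_mul_pseudoInverse hB hA h₁ hT] at e₂
  obtain ⟨σ, hσA, hσ⟩ := exists_perm_of_eigen_eq hA hA' (fun i => div_ne_zero (h₁ i) (h₂ i))
    hl' hinj hsA hsA' e₁
  obtain ⟨τ, hτB, hτ⟩ := exists_perm_of_eigen_eq hB hB' (fun i => div_ne_zero (h₂ i) (h₁ i))
    (fun i => inv_ne_zero (hl' i))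
    (fun i j hij => hinj (inv_injective (by simpa only [inv_div] using hij))) hsB hsB' e₂
  have hστ : σ = τ := by
    ext1 j
    apply hinj
    have := hτ j
    rw [hσ, inv_div] at this
    have e := congrArg (·⁻¹) this
    simpa only [inv_div] using e
  subst hστ
  refine ⟨σ, hσA, ?_⟩
  have hK : C * (khatriRao A B).transpose
      = C.submatrix id σ * (khatriRao A' B').transpose := by
    ext a r
    rw [mul_apply, mul_apply, ← σ.sum_comp, hσA, hτB]
    rfl
  rw [hC', matricize₃_tensorOf, hK, Matrix.mul_assoc, ← transpose_mul,
    pinv_mul (rank_khatriRao hA' hB'), transpose_one, Matrix.mul_one]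

end

namespace HMM

variable {d k : ℕ} {θ : HMM d k} {p : Fin k → ℝ}

theorem sum_factorA (hp : θ.IsStationary p) (n : ℕ) (i : Fin k) :
    ∑ w, θ.factorA n w i = 1 := by
  rw [← future_mul_Q θ hp]
  simp only [QuasiHMM.future_mul_apply]
  rw [← Finset.sum_apply, ← sum_vecMul, QuasiHMM.sum_futureVec]
  exact congrFun θ.vecMul_Q i

theorem sum_factorB (hp : θ.IsStationary p) (hpos : ∀ i, 0 < p i) (n : ℕ) (i : Fin k) :
    ∑ w, θ.factorB p n w i = 1 := by
  have h1 : (∑ w, θ.factorB p n w i) * p i = p i := by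
    rw [Finset.sum_mul]
    simp_rw [← mul_diagonal, ← past_eq θ hp hpos]
    have := congrFun ((θ.toQuasi p hp).sum_pastVec n) i
    rwa [Finset.sum_apply] at this
  exact mul_right_cancel₀ (hpos i).ne' (h1.trans (one_mul _).symm)

theorem marginalize_factorA (hp : θ.IsStationary p) (n : ℕ) :
    marginalize (θ.factorA (n + 1)) = θ.factorA n := by
  rw [← future_mul_Q θ hp, marginalize_mul, QuasiHMM.marginalize_future, future_mul_Q]

theorem rank_factorA_mono (hp : θ.IsStationary p) {n n' : ℕ} (h : n ≤ n')
    (hA : (θ.factorA n).rank = k) : (θ.factorA n').rank = k := by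
  induction n', h using Nat.le_induction with
  | base => exact hA
  | succ n' _ ih => exact rank_of_rank_marginalize (by rw [marginalize_factorA hp, ih])

theorem rank_factorB_mono (hp : θ.IsStationary p) (hpos : ∀ i, 0 < p i) {n n' : ℕ} (h : n ≤ n')
    (hB : (θ.factorB p n).rank = k) : (θ.factorB p n').rank = k := by
  induction n', h using Nat.le_induction with
  | base => exact hB
  | succ n' _ ih =>
    rw [← rank_past hp hpos] at ih ⊢
    exact rank_of_rank_marginalize (by rw [QuasiHMM.marginalize_past, ih])

theorem recoverO_factorC (hpos : ∀ i, 0 < p i) {k' : ℕ} (σ : Fin k' ≃ Fin k) :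
    recoverO ((θ.factorC p).submatrix id σ) = θ.O.submatrix id σ := by
  ext a i
  simp only [recoverO, of_apply, submatrix_apply, factorC, mul_diagonal, id, ← Finset.sum_mul,
    θ.O_sum, one_mul]
  exact mul_div_cancel_right₀ _ (hpos _).ne'

theorem recoverQ_factorA (hp : θ.IsStationary p) {n : ℕ} (hA : (θ.factorA (n + 1)).rank = k)
    {k' : ℕ} (σ : Fin k' ≃ Fin k) :
    recoverQ (θ.O.submatrix id σ) (n + 1) ((θ.factorA (n + 1)).submatrix id σ)
      = θ.Q.submatrix σ σ := by
  set K := khatriRaoCons θ.O (θ.factorA n) with hK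
  have hKQ : θ.factorA (n + 1) = K * θ.Q := rfl
  have hKr : K.rank = k := rank_eq_of_rank_mul (X := θ.Q) hA
  have hKr' : (K.submatrix id σ).rank = k' := by
    apply rank_eq_of_leftInverse (L := (pinv K).submatrix σ id)
    rw [← submatrix_mul _ _ _ _ _ Function.bijective_id, pinv_mul hKr, submatrix_one_equiv]
  have hmar : khatriRaoCons (θ.O.submatrix id σ)
      (marginalize ((θ.factorA (n + 1)).submatrix id σ)) = K.submatrix id σ := by
    rw [hK, ← marginalize_factorA hp n]
    rfl
  rw [recoverQ, hmar, hKQ, ← submatrix_mul_equiv K θ.Q id σ σ, ← Matrix.mul_assoc,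
    pinv_mul hKr', Matrix.one_mul]

end HMM

theorem ae_sphereMeasure_sum_ne_zero {d : ℕ} {c : Fin d → ℝ} (hc : c ≠ 0) :
    ∀ᵐ (v : Metric.sphere (0 : EuclideanSpace ℝ (Fin d)) 1) ∂(sphereMeasure d),
      ∑ a, c a * (v : EuclideanSpace ℝ (Fin d)) a ≠ 0 := by
  let f : EuclideanSpace ℝ (Fin d) →L[ℝ] ℝ := ∑ a, c a • EuclideanSpace.proj a
  have hf : ∀ v, f v = ∑ a, c a * v a := fun v => by simp [f]
  have hker : LinearMap.ker f.toLinearMap ≠ ⊤ := by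
    intro htop
    apply hc
    ext a
    have hm : EuclideanSpace.single a (1 : ℝ) ∈ LinearMap.ker f.toLinearMap := by
      rw [htop]
      trivial
    have hm' : f (EuclideanSpace.single a (1 : ℝ)) = 0 := hm
    rw [hf, Finset.sum_eq_single a] at hm'
    · simpa using hm'
    · intro b _ hb
      simp [hb]
    · simp
  have hnull := Measure.addHaar_submodule (volume : Measure (EuclideanSpace ℝ (Fin d))) _ hker
  simp_rw [← hf]
  rw [ae_iff]
  simp only [not_not]
  have hmeas : MeasurableSet {v : Metric.sphere (0 : EuclideanSpace ℝ (Fin d)) 1 | f v = 0} :=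
    (isClosed_eq (f.continuous.comp continuous_subtype_val) continuous_const).measurableSet
  rw [sphereMeasure, Measure.toSphere_apply' _ hmeas]
  refine mul_eq_zero_of_right _ (measure_mono_null ?_ hnull)
  rintro x hx
  obtain ⟨r, -, y, ⟨v, hv, rfl⟩, rfl⟩ := Set.mem_smul.mp hx
  have hv' : f v = 0 := hv
  change f (r • (v : EuclideanSpace ℝ (Fin d))) = 0
  rw [map_smul, hv', smul_zero]

instance (d : ℕ) : IsFiniteMeasure (sphereMeasure d) := by
  unfold sphereMeasure
  infer_instance

/-- For almost all pairs of unit vectors, the contractions of the columns `O_i p_i` with the two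
vectors are nonzero and have pairwise distinct ratios. -/
theorem ae_sphereMeasure_prod_injective {d k : ℕ} {O : Matrix (Fin d) (Fin k) ℝ} {p : Fin k → ℝ}
    (hsum : ∀ i, ∑ a, O a i = 1) (hO : ∀ i i', (∀ a, O a i = O a i') → i = i')
    (hp : ∀ i, p i ≠ 0) :
    ∀ᵐ v ∂((sphereMeasure d).prod (sphereMeasure d)),
      (∀ i, ∑ a, (O * diagonal p) a i * (v.1 : EuclideanSpace ℝ (Fin d)) a ≠ 0) ∧
      (∀ i, ∑ a, (O * diagonal p) a i * (v.2 : EuclideanSpace ℝ (Fin d)) a ≠ 0) ∧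
      Function.Injective fun i =>
        (∑ a, (O * diagonal p) a i * (v.1 : EuclideanSpace ℝ (Fin d)) a)
          / ∑ a, (O * diagonal p) a i * (v.2 : EuclideanSpace ℝ (Fin d)) a := by
  set C := O * diagonal p with hC
  have hCs : ∀ i, ∑ a, C a i = p i := fun i => by
    simp_rw [hC, mul_diagonal, ← Finset.sum_mul, hsum, one_mul]
  have h1 : ∀ᵐ (v : Metric.sphere (0 : EuclideanSpace ℝ (Fin d)) 1) ∂(sphereMeasure d), ∀ i,
      ∑ a, C a i * (v : EuclideanSpace ℝ (Fin d)) a ≠ 0 := by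
    rw [ae_all_iff]
    intro i
    refine ae_sphereMeasure_sum_ne_zero (c := fun a => C a i) fun h0 => hp i ?_
    rw [← hCs]
    exact Finset.sum_eq_zero fun a _ => congrFun h0 a
  let z : EuclideanSpace ℝ (Fin d) → Fin k → ℝ := fun v i => ∑ a, C a i * v a
  have hz : ∀ i, Continuous fun v => z v i := fun i => by
    simp only [z]
    fun_prop
  have h3 : ∀ᵐ v ∂((sphereMeasure d).prod (sphereMeasure d)), ∀ i j, i ≠ j →
      (∀ i, z v.1 i ≠ 0) → z v.1 i * z v.2 j - z v.1 j * z v.2 i ≠ 0 := by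
    rw [ae_all_iff]
    intro i
    rw [ae_all_iff]
    intro j
    by_cases hij : i = j
    · exact Filter.Eventually.of_forall fun v h => absurd hij h
    have hmeas : MeasurableSet {v : Metric.sphere (0 : EuclideanSpace ℝ (Fin d)) 1 ×
        Metric.sphere (0 : EuclideanSpace ℝ (Fin d)) 1 |
        (i ≠ j → (∀ i, z v.1 i ≠ 0) → z v.1 i * z v.2 j - z v.1 j * z v.2 i ≠ 0)} := by
      have hm1 : ∀ i, Measurable fun v : Metric.sphere (0 : EuclideanSpace ℝ (Fin d)) 1 ×
          Metric.sphere (0 : EuclideanSpace ℝ (Fin d)) 1 => z v.1 i := fun i =>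
        ((hz i).measurable.comp measurable_subtype_coe).comp measurable_fst
      have hm2 : ∀ i, Measurable fun v : Metric.sphere (0 : EuclideanSpace ℝ (Fin d)) 1 ×
          Metric.sphere (0 : EuclideanSpace ℝ (Fin d)) 1 => z v.2 i := fun i =>
        ((hz i).measurable.comp measurable_subtype_coe).comp measurable_snd
      refine MeasurableSet.imp (MeasurableSet.const _) (MeasurableSet.imp ?_ ?_)
      · rw [Set.ofPred_forall]
        exact MeasurableSet.iInter fun i =>
          (measurableSet_eq_fun (hm1 i) measurable_const).compl
      · exact (measurableSet_eq_fun (((hm1 i).mul (hm2 j)).sub ((hm1 j).mul (hm2 i)))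
          measurable_const).compl
    rw [Measure.ae_prod_iff_ae_ae hmeas]
    refine Filter.Eventually.of_forall fun v => ?_
    by_cases hv : ∀ i, z v i ≠ 0
    · have hne : (fun a => z v i * C a j - z v j * C a i) ≠ 0 := by
        intro h0
        have h0' : ∀ a, z v i * C a j = z v j * C a i := fun a => sub_eq_zero.mp (congrFun h0 a)
        have hs : z v i * p j = z v j * p i := by
          rw [← hCs, ← hCs, Finset.mul_sum, Finset.mul_sum]
          exact Finset.sum_congr rfl fun a _ => h0' a
        refine hij (hO i j fun a => ?_)
        have ha := h0' a
        rw [hC, mul_diagonal, mul_diagonal] at ha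
        have : (z v i * p j) * O a i = (z v i * p j) * O a j := by
          linear_combination (O a i) * hs - ha
        exact mul_left_cancel₀ (mul_ne_zero (hv i) (hp j)) this
      filter_upwards [ae_sphereMeasure_sum_ne_zero hne] with w hw _ _
      convert hw using 1
      simp only [z, Finset.mul_sum, ← Finset.sum_sub_distrib, sub_mul]
      exact Finset.sum_congr rfl fun a _ => by ring
    · exact Filter.Eventually.of_forall fun w _ h => absurd h hv
  filter_upwards [Measure.quasiMeasurePreserving_fst.ae h1,
    Measure.quasiMeasurePreserving_snd.ae h1, h3] with v hv1 hv2 hv3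
  refine ⟨hv1, hv2, fun i j hij => ?_⟩
  by_contra hne
  refine hv3 i j hne hv1 (sub_eq_zero.mpr ?_)
  rwa [div_eq_div_iff (hv2 i) (hv2 j)] at hij

/-- The continuous functions which are polynomial on every line. -/
def linePolynomials (E : Type*) [NormedAddCommGroup E] [NormedSpace ℝ E] :
    Subalgebra ℝ (E → ℝ) where
  carrier := {f | Continuous f ∧ ∀ x y, ∃ P : Polynomial ℝ, ∀ t : ℝ, f (x + t • y) = P.eval t}
  mul_mem' := by
    rintro f g ⟨hf, hf'⟩ ⟨hg, hg'⟩
    refine ⟨hf.mul hg, fun x y => ?_⟩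
    obtain ⟨P, hP⟩ := hf' x y
    obtain ⟨R, hR⟩ := hg' x y
    exact ⟨P * R, fun t => by rw [Polynomial.eval_mul, ← hP, ← hR]; rfl⟩
  add_mem' := by
    rintro f g ⟨hf, hf'⟩ ⟨hg, hg'⟩
    refine ⟨hf.add hg, fun x y => ?_⟩
    obtain ⟨P, hP⟩ := hf' x y
    obtain ⟨R, hR⟩ := hg' x y
    exact ⟨P + R, fun t => by rw [Polynomial.eval_add, ← hP, ← hR]; rfl⟩
  algebraMap_mem' r := ⟨continuous_const, fun _ _ => ⟨Polynomial.C r, fun t => by simp⟩⟩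

section

variable {E : Type*} [NormedAddCommGroup E] [NormedSpace ℝ E]

theorem continuousLinearMap_mem_linePolynomials (f : E →L[ℝ] ℝ) :
    (fun x => f x) ∈ linePolynomials E :=
  ⟨f.continuous, fun x y => ⟨Polynomial.C (f x) + Polynomial.X * Polynomial.C (f y), fun t => by
    simp
    ring⟩⟩

/-- The zero set of a function which is polynomial on lines, and not identically zero, is null. -/
theorem measure_zeroSet_linePolynomial [MeasurableSpace E] [BorelSpace E] [FiniteDimensional ℝ E]
    (μ : Measure E) [μ.IsAddHaarMeasure] {f : E → ℝ} (hf : f ∈ linePolynomials E) {x₀ : E}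
    (h₀ : f x₀ ≠ 0) : μ {x | f x = 0} = 0 := by
  obtain ⟨hcont, hpoly⟩ := hf
  have hfin : ∀ x : E, ∀ᵐ t : ℝ, f (x₀ + t • x) ≠ 0 := by
    intro x
    obtain ⟨P, hP⟩ := hpoly x₀ x
    have hP0 : P ≠ 0 := by
      rintro rfl
      apply h₀
      simpa using hP 0
    simp_rw [hP, ae_iff, not_not]
    exact (Polynomial.finite_setOfPred_isRoot hP0).measure_zero _
  have hmeas : MeasurableSet {z : E × ℝ | f (x₀ + z.2 • z.1) ≠ 0} := by
    have hc : Continuous fun z : E × ℝ => f (x₀ + z.2 • z.1) := hcont.comp (by fun_prop)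
    exact (isOpen_ne_fun hc continuous_const).measurableSet
  have hswap : ∀ᵐ t : ℝ, ∀ᵐ x ∂μ, f (x₀ + t • x) ≠ 0 :=
    (Measure.ae_ae_comm hmeas).mp (Filter.Eventually.of_forall hfin)
  obtain ⟨t, ht, ht0⟩ := (hswap.and (Measure.ae_ne volume (0 : ℝ))).exists
  rw [ae_iff] at ht
  simp only [not_not] at ht
  have hpre : {x | f (x₀ + t • x) = 0}
      = (fun x => t • x) ⁻¹' ((fun x => x₀ + x) ⁻¹' {x | f x = 0}) := rfl
  rw [hpre, Measure.addHaar_preimage_smul μ ht0, measure_preimage_add, mul_eq_zero] at ht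
  refine ht.resolve_left ?_
  simp [ht0]

theorem mul_mem_linePolynomials {l m n : Type*} [Fintype m] {X : E → Matrix l m ℝ} {Y : E → Matrix m n ℝ}
    (hX : ∀ i j, (fun x => X x i j) ∈ linePolynomials E)
    (hY : ∀ i j, (fun x => Y x i j) ∈ linePolynomials E) (i : l) (j : n) :
    (fun x => (X x * Y x) i j) ∈ linePolynomials E := by
  have : (fun x => (X x * Y x) i j)
      = ∑ s, (fun x => X x i s) * fun x => Y x s j := by
    ext x
    rw [mul_apply, Finset.sum_apply]
    rfl
  rw [this]
  exact sum_mem fun s _ => mul_mem (hX i s) (hY s j)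

variable {m n : Type*} [Fintype m] [Fintype n]

theorem det_mem_linePolynomials [DecidableEq n] {X : E → Matrix n n ℝ}
    (hX : ∀ i j, (fun x => X x i j) ∈ linePolynomials E) :
    (fun x => (X x).det) ∈ linePolynomials E := by
  have : (fun x => (X x).det) = ∑ s : Equiv.Perm n,
      ((Equiv.Perm.sign s : ℤ) : ℝ) • ∏ i, fun x => X x (s i) i := by
    ext x
    rw [det_apply', Finset.sum_apply]
    simp
  rw [this]
  exact sum_mem fun s _ => Subalgebra.smul_mem _ (prod_mem fun i _ => hX _ _) _

theorem det_gram_mem_linePolynomials [DecidableEq n] {X : E → Matrix m n ℝ}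
    (hX : ∀ i j, (fun x => X x i j) ∈ linePolynomials E) :
    (fun x => ((X x).transpose * X x).det) ∈ linePolynomials E :=
  det_mem_linePolynomials
    (mul_mem_linePolynomials (X := fun x => (X x).transpose) (fun i j => hX j i) hX)

theorem cramer_mem_linePolynomials [DecidableEq n] {X : E → Matrix n n ℝ} {b : n → ℝ}
    (hX : ∀ i j, (fun x => X x i j) ∈ linePolynomials E) (i : n) :
    (fun x => (X x).cramer b i) ∈ linePolynomials E := by
  simp_rw [cramer_apply]
  refine det_mem_linePolynomials fun i' j => ?_
  by_cases h : j = i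
  · subst h
    simp only [updateCol_self]
    exact algebraMap_mem (linePolynomials E) (b i')
  · simpa only [updateCol_ne h] using hX i' j

end

/-- The matrices obtained from the recursion of `condMatrix` when started from a row `r`. -/
def startMatrix {d k : ℕ} (Q : Matrix (Fin k) (Fin k) ℝ) (O : Matrix (Fin d) (Fin k) ℝ)
    (r : Fin k → ℝ) : (n : ℕ) → Matrix (Fin n → Fin d) (Fin k) ℝ
  | 0 => Matrix.of fun _ i => r i
  | n + 1 => khatriRaoCons O (startMatrix Q O r n) * Q

theorem startMatrix_one {d k : ℕ} (Q : Matrix (Fin k) (Fin k) ℝ) (O : Matrix (Fin d) (Fin k) ℝ)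
    (n : ℕ) : startMatrix Q O (fun _ => 1) n = condMatrix Q O n := by
  induction n with
  | zero => rfl
  | succ n ih => rw [startMatrix, condMatrix, ih]

theorem startMatrix_smul {d k : ℕ} (Q : Matrix (Fin k) (Fin k) ℝ) (O : Matrix (Fin d) (Fin k) ℝ)
    (c : ℝ) (r : Fin k → ℝ) (n : ℕ) :
    startMatrix Q O (c • r) n = c • startMatrix Q O r n := by
  induction n with
  | zero => rfl
  | succ n ih =>
    rw [startMatrix, startMatrix, ih, ← smul_mul]
    congr 1
    ext w i
    simp only [khatriRaoCons, of_apply, Matrix.smul_apply, smul_eq_mul]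
    ring

theorem startMatrix_mem_linePolynomials {E : Type*} [NormedAddCommGroup E] [NormedSpace ℝ E]
    {d k : ℕ} {Q : E → Matrix (Fin k) (Fin k) ℝ} {O : E → Matrix (Fin d) (Fin k) ℝ}
    {r : E → Fin k → ℝ} (hQ : ∀ i j, (fun x => Q x i j) ∈ linePolynomials E)
    (hO : ∀ a i, (fun x => O x a i) ∈ linePolynomials E)
    (hr : ∀ i, (fun x => r x i) ∈ linePolynomials E) (n : ℕ) (w : Fin n → Fin d) (i : Fin k) :
    (fun x => startMatrix (Q x) (O x) (r x) n w i) ∈ linePolynomials E := by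
  induction n generalizing i with
  | zero => exact hr i
  | succ n ih =>
    exact mul_mem_linePolynomials (X := fun x => khatriRaoCons (O x)
      (startMatrix (Q x) (O x) (r x) n)) (fun w i => mul_mem (hO (w 0) i) (ih (Fin.tail w) i)) hQ w i

/-- The matrix with column sums one and prescribed rows except for the last one. -/
def completeRows {r c : ℕ} (x : {i : Fin r // (i : ℕ) + 1 < r} → Fin c → ℝ) :
    Matrix (Fin r) (Fin c) ℝ :=
  Matrix.of fun i j => if h : (i : ℕ) + 1 < r then x ⟨i, h⟩ j else 1 - ∑ i', x i' j

theorem completeRows_restrict {r c : ℕ} {M : Matrix (Fin r) (Fin c) ℝ}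
    (hM : ∀ j, ∑ i, M i j = 1) :
    completeRows (fun (i : {i : Fin r // (i : ℕ) + 1 < r}) j => M i j) = M := by
  ext i j
  rw [completeRows, of_apply]
  split_ifs with h
  · rfl
  · rw [← hM j, ← Fintype.sum_subtype_add_sum_subtype (fun i : Fin r => (i : ℕ) + 1 < r)
      fun i => M i j, add_sub_cancel_left]
    have : Subsingleton {i : Fin r // ¬ (i : ℕ) + 1 < r} :=
      ⟨fun a b => Subtype.ext (Fin.ext (by have := a.2; have := b.2; omega))⟩
    exact Fintype.sum_subsingleton _ (⟨i, h⟩ : {i : Fin r // ¬ (i : ℕ) + 1 < r})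

theorem completeRows_mem_linePolynomials {E : Type*} [NormedAddCommGroup E] [NormedSpace ℝ E]
    {r c : ℕ} (f : E →L[ℝ] ({i : Fin r // (i : ℕ) + 1 < r} → Fin c → ℝ)) (i : Fin r) (j : Fin c) :
    (fun x => completeRows (f x) i j) ∈ linePolynomials E := by
  have hent : ∀ i, (fun x => f x i j) ∈ linePolynomials E := fun i =>
    continuousLinearMap_mem_linePolynomials
      ((ContinuousLinearMap.proj j).comp ((ContinuousLinearMap.proj i).comp f))
  simp only [completeRows, of_apply]
  split_ifs with h
  · exact hent _
  · have : (fun x => 1 - ∑ i', f x i' j) = 1 - ∑ i', fun x => f x i' j := by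
      ext x
      simp
    rw [this]
    exact sub_mem (one_mem _) (sum_mem fun i' _ => hent i')

/-- The matrix `I - Q + e eᵀ`, mapping stationary distributions of `Q` to `e`. -/
def stationaryMatrix {k : ℕ} (Q : Matrix (Fin k) (Fin k) ℝ) : Matrix (Fin k) (Fin k) ℝ :=
  1 - Q + Matrix.of fun _ _ => 1

theorem stationaryMatrix_mulVec {k : ℕ} (Q : Matrix (Fin k) (Fin k) ℝ) (v : Fin k → ℝ) :
    (stationaryMatrix Q).mulVec v = v - Q.mulVec v + fun _ => ∑ i, v i := by
  rw [stationaryMatrix, add_mulVec, sub_mulVec, one_mulVec]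
  congr 1
  ext i
  simp [mulVec, dotProduct]

theorem sum_mulVec_eq_sum {k : ℕ} {Q : Matrix (Fin k) (Fin k) ℝ} (hQ : ∀ j, ∑ i, Q i j = 1)
    (v : Fin k → ℝ) : ∑ i, Q.mulVec v i = ∑ i, v i := by
  simp only [mulVec, dotProduct]
  rw [Finset.sum_comm]
  simp_rw [← Finset.sum_mul, hQ, one_mul]

theorem sum_stationaryMatrix_mulVec {k : ℕ} {Q : Matrix (Fin k) (Fin k) ℝ}
    (hQ : ∀ j, ∑ i, Q i j = 1) (v : Fin k → ℝ) :
    ∑ i, (stationaryMatrix Q).mulVec v i = k * ∑ i, v i := by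
  rw [stationaryMatrix_mulVec]
  simp only [Pi.add_apply, Pi.sub_apply, Finset.sum_add_distrib, Finset.sum_sub_distrib,
    sum_mulVec_eq_sum hQ]
  simp

namespace HMM

variable {d k : ℕ}

theorem IsStationary.stationaryMatrix_mulVec {θ : HMM d k} {p : Fin k → ℝ}
    (hp : θ.IsStationary p) : (stationaryMatrix θ.Q).mulVec p = fun _ => 1 := by
  rw [_root_.stationaryMatrix_mulVec, hp.2.2, hp.2.1, sub_self, zero_add]

theorem IsStationary.cramer_eq {θ : HMM d k} {p : Fin k → ℝ} (hp : θ.IsStationary p)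
    (hdet : (stationaryMatrix θ.Q).det ≠ 0) :
    (stationaryMatrix θ.Q).cramer (fun _ => 1) = (stationaryMatrix θ.Q).det • p := by
  have hinj := mulVec_injective_of_isUnit
    ((isUnit_iff_isUnit_det (stationaryMatrix θ.Q)).mpr hdet.isUnit)
  apply hinj
  rw [mulVec_cramer, mulVec_smul, hp.stationaryMatrix_mulVec]

/-- An HMM with positive transition probabilities and with `I - Q + e eᵀ` invertible has exactly
one stationary distribution, and this distribution is positive. -/
theorem exists_stationary (θ : HMM d k) (hk : 1 ≤ k) (hpos : ∀ i j, 0 < θ.Q i j)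
    (hdet : (stationaryMatrix θ.Q).det ≠ 0) :
    ∃ p, θ.IsStationary p ∧ (∀ p', θ.IsStationary p' → p' = p) ∧ ∀ i, 0 < p i := by
  have hR := (isUnit_iff_isUnit_det (stationaryMatrix θ.Q)).mpr hdet.isUnit
  have hinj := mulVec_injective_of_isUnit hR
  obtain ⟨r, hr⟩ := (mulVec_surjective_iff_isUnit.mpr hR) (fun _ => 1)
  have hk0 : (k : ℝ) ≠ 0 := by
    exact_mod_cast (by omega : k ≠ 0)
  have hsum : ∑ i, r i = 1 := by
    have := sum_stationaryMatrix_mulVec θ.Q_sum r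
    rw [hr] at this
    simp only [Finset.sum_const, Finset.card_univ, Fintype.card_fin, nsmul_eq_mul, mul_one] at this
    exact mul_left_cancel₀ hk0 (this.symm.trans (mul_one _).symm)
  have hfix : θ.Q.mulVec r = r := by
    ext i
    have := congrFun hr i
    rw [_root_.stationaryMatrix_mulVec] at this
    simp only [Pi.add_apply, Pi.sub_apply, hsum] at this
    linarith
  have habs_le : ∀ i, |r i| ≤ θ.Q.mulVec (fun j => |r j|) i := by
    intro i
    calc |r i| = |∑ j, θ.Q i j * r j| := congrArg _ (congrFun hfix i).symm
      _ ≤ ∑ j, |θ.Q i j * r j| := Finset.abs_sum_le_sum_abs _ _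
      _ = ∑ j, θ.Q i j * |r j| :=
        Finset.sum_congr rfl fun j _ => by rw [abs_mul, abs_of_nonneg (θ.Q_nonneg i j)]
  have habs : θ.Q.mulVec (fun j => |r j|) = fun j => |r j| := by
    have := (Finset.sum_eq_sum_iff_of_le (s := Finset.univ) (f := fun i => |r i|)
      fun i _ => habs_le i).mp (sum_mulVec_eq_sum θ.Q_sum fun j => |r j|).symm
    ext i
    exact (this i (Finset.mem_univ i)).symm
  set c := ∑ i, |r i| with hc
  have hcpos : 0 < c :=
    zero_lt_one.trans_le (hsum.symm.le.trans (Finset.sum_le_sum fun i _ => le_abs_self (r i)))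
  have huniq : ∀ p', θ.IsStationary p' → p' = r := fun p' hp' =>
    hinj (hp'.stationaryMatrix_mulVec.trans hr.symm)
  have hstat : θ.IsStationary (c⁻¹ • fun j => |r j|) := by
    refine ⟨fun i => mul_nonneg (inv_nonneg.mpr hcpos.le) (abs_nonneg _), ?_, ?_⟩
    · simp only [Pi.smul_apply, smul_eq_mul, ← Finset.mul_sum]
      exact inv_mul_cancel₀ hcpos.ne'
    · rw [mulVec_smul, habs]
  have heq := huniq _ hstat
  rw [heq] at hstat
  refine ⟨r, hstat, huniq, fun i => ?_⟩
  rw [← hfix]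
  obtain ⟨j, hj⟩ : ∃ j, r j ≠ 0 := by
    by_contra! h0
    simp [h0] at hsum
  exact Finset.sum_pos' (fun j _ => mul_nonneg (θ.Q_nonneg i j) (hstat.1 j))
    ⟨j, Finset.mem_univ j, mul_pos (hpos i j) (lt_of_le_of_ne (hstat.1 j) hj.symm)⟩

theorem startMatrix_eq_factorB (θ : HMM d k) {p : Fin k → ℝ} (hpos : ∀ i, 0 < p i) (n : ℕ) :
    startMatrix θ.Q.transpose θ.O p n = θ.factorB p n * diagonal p := by
  induction n with
  | zero =>
    ext w i
    rw [mul_diagonal]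
    simp [factorB, condMatrix, startMatrix]
  | succ n ih =>
    change _ = khatriRaoCons θ.O (θ.factorB p n) * θ.backward p * diagonal p
    rw [startMatrix, ih, Matrix.mul_assoc, backward,
      Matrix.mul_assoc, nonsing_inv_mul _ (isUnit_det_diagonal hpos), Matrix.mul_one,
      ← Matrix.mul_assoc]
    congr 1
    ext w i
    simp only [khatriRaoCons, of_apply, mul_diagonal, mul_assoc]

end HMM

/-- The words on `ZMod k` for which the windows of length `n` at two given positions agree are
few. -/
theorem card_windows_eq_le {d k n s : ℕ} [NeZero k] (i : ZMod k) (hs : 1 ≤ s) (hs' : 2 * s ≤ k)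
    (hn : 2 * n ≤ k) :
    Fintype.card {f : ZMod k → Fin d // ∀ t < n, f (i + (t : ℕ)) = f (i + (s + t : ℕ))}
      ≤ d ^ (k - n) := by
  have hcard : Fintype.card (Fin (k - n) → Fin d) = d ^ (k - n) := by simp
  rw [← hcard]
  refine Fintype.card_le_of_injective
    (fun f (u : Fin (k - n)) => f.1 (i + (n + u : ℕ))) fun f g hfg => ?_
  have key : ∀ r u, u < k → k - u ≤ r → f.1 (i + (u : ℕ)) = g.1 (i + (u : ℕ)) := by
    intro r
    induction r with
    | zero => intro u hu h; omega
    | succ r ih =>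
      intro u hu h
      by_cases hun : n ≤ u
      · have := congrFun hfg ⟨u - n, by omega⟩
        simpa [Nat.add_sub_cancel' hun] using this
      · rw [f.2 u (by omega), g.2 u (by omega)]
        exact ih _ (by omega) (by omega)
  ext1
  funext z
  have := key k (z - i).val (ZMod.val_lt _) (by omega)
  simpa using this

/-- For `k ≤ d ^ m`, there is a cyclic word of length `k` over `d` letters whose windows of length
`8 m` are pairwise distinct. -/
theorem exists_word_windows_injective {d k m : ℕ} [NeZero k] (hd : 2 ≤ d) (hkm : k ≤ d ^ m) :
    ∃ f : ZMod k → Fin d, ∀ i j : ZMod k,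
      (∀ t < 8 * m, f (i + (t : ℕ)) = f (j + (t : ℕ))) → i = j := by
  classical
  by_cases hk : 4 * m ≤ k
  · let bad : ZMod k × Fin (k / 2) → Finset (ZMod k → Fin d) := fun z =>
      Finset.univ.filter fun f =>
        ∀ t < 2 * m, f (z.1 + (t : ℕ)) = f (z.1 + (((z.2 : ℕ) + 1 + t : ℕ)))
    have hbad : ∀ z, (bad z).card ≤ d ^ (k - 2 * m) := by
      intro z
      rw [← Fintype.card_subtype]
      have := z.2.2
      exact card_windows_eq_le z.1 (by omega) (by omega) (by omega)
    have hkpos : 0 < k := Nat.pos_of_ne_zero (NeZero.ne k)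
    have hlt : (Finset.univ.biUnion bad).card < Fintype.card (ZMod k → Fin d) := by
      calc (Finset.univ.biUnion bad).card ≤ ∑ z, (bad z).card := Finset.card_biUnion_le
        _ ≤ ∑ _z : ZMod k × Fin (k / 2), d ^ (k - 2 * m) := Finset.sum_le_sum fun z _ => hbad z
        _ = k * (k / 2) * d ^ (k - 2 * m) := by simp [ZMod.card]
        _ < d ^ (2 * m) * d ^ (k - 2 * m) := by
          apply Nat.mul_lt_mul_of_pos_right
          · calc k * (k / 2) < k * k := Nat.mul_lt_mul_of_pos_left (by omega) hkpos
              _ ≤ d ^ m * d ^ m := Nat.mul_le_mul hkm hkm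
              _ = d ^ (2 * m) := by rw [← pow_add, two_mul]
          · positivity
        _ = d ^ k := by rw [← pow_add]; congr 1; omega
        _ = Fintype.card (ZMod k → Fin d) := by simp [ZMod.card]
    obtain ⟨f, -, hf⟩ := Finset.exists_mem_notMem_of_card_lt_card
      (s := Finset.univ.biUnion bad) (t := Finset.univ) (by rwa [Finset.card_univ])
    have hstep : ∀ (i : ZMod k) (s : ℕ), 1 ≤ s → 2 * s ≤ k →
        ¬ ∀ t < 8 * m, f (i + (t : ℕ)) = f (i + (s : ℕ) + (t : ℕ)) := by
      intro i s hs hs' h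
      apply hf
      rw [Finset.mem_biUnion]
      refine ⟨(i, ⟨s - 1, by omega⟩), Finset.mem_univ _, ?_⟩
      simp only [bad, Finset.mem_filter, Finset.mem_univ, true_and]
      intro t ht
      rw [Nat.sub_add_cancel hs, h t (by omega), Nat.cast_add, add_assoc]
    refine ⟨f, fun i j h => ?_⟩
    by_contra hij
    have hne : j - i ≠ 0 := sub_ne_zero.mpr (Ne.symm hij)
    have hne' : i - j ≠ 0 := sub_ne_zero.mpr hij
    have hv : (j - i).val ≠ 0 := fun h0 => hne ((ZMod.val_eq_zero _).mp h0)
    have hv' : (i - j).val ≠ 0 := fun h0 => hne' ((ZMod.val_eq_zero _).mp h0)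
    have hadd : (i - j).val = k - (j - i).val := by
      have : NeZero (j - i) := ⟨hne⟩
      rw [← neg_sub j i, ZMod.val_neg_of_ne_zero]
    rcases le_or_gt (2 * (j - i).val) k with hle | hgt
    · refine hstep i (j - i).val (by omega) hle fun t ht => ?_
      rw [h t ht, ZMod.natCast_zmod_val, add_sub_cancel]
    · refine hstep j (i - j).val (by omega) (by omega) fun t ht => ?_
      rw [← h t ht, ZMod.natCast_zmod_val, add_sub_cancel]
  · refine ⟨fun x => if x = 0 then ⟨1, by omega⟩ else ⟨0, by omega⟩, fun i j h => ?_⟩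
    have hlt := ZMod.val_lt (-i)
    have := h (-i).val (by omega)
    simp only [ZMod.natCast_zmod_val, add_neg_cancel, if_true] at this
    split_ifs at this with h0
    · rw [← sub_eq_add_neg, sub_eq_zero] at h0
      exact h0.symm
    · simp at this

/-- A cyclic permutation of `k` states and a labelling of the states by letters for which the
labels along the orbits, in both directions, determine the state. -/
theorem exists_perm_word {d k m : ℕ} (hd : 2 ≤ d) (hk : 1 ≤ k) (hkm : k ≤ d ^ m) :
    ∃ (τ : Equiv.Perm (Fin k)) (g : Fin k → Fin d), (∀ i j, ∃ t : ℕ, (τ ^ t) i = j) ∧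
      (∀ i j, (∀ t < 8 * m, g ((τ ^ (t + 1)) i) = g ((τ ^ (t + 1)) j)) → i = j) ∧
      (∀ i j, (∀ t < 8 * m, g ((τ⁻¹ ^ (t + 1)) i) = g ((τ⁻¹ ^ (t + 1)) j)) → i = j) := by
  have : NeZero k := ⟨by omega⟩
  obtain ⟨f, hf⟩ := exists_word_windows_injective (k := k) hd hkm
  let e : Fin k ≃ ZMod k := (ZMod.finEquiv k).toEquiv
  let τ : Equiv.Perm (Fin k) := (e.trans (Equiv.addRight 1)).trans e.symm
  have hτ : ∀ (t : ℕ) i, e ((τ ^ t) i) = e i + (t : ℕ) := by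
    intro t
    induction t with
    | zero => simp
    | succ t ih =>
      intro i
      rw [pow_succ, Equiv.Perm.mul_apply, ih]
      simp only [τ, Equiv.trans_apply, Equiv.apply_symm_apply, Equiv.coe_addRight]
      push_cast
      ring
  have hτ' : ∀ (t : ℕ) i, e ((τ⁻¹ ^ t) i) = e i - (t : ℕ) := by
    intro t i
    rw [eq_sub_iff_add_eq, ← hτ, inv_pow, ← Equiv.Perm.mul_apply, mul_inv_cancel]
    rfl
  refine ⟨τ, fun x => f (e x), fun i j => ⟨(e j - e i).val, e.injective ?_⟩, fun i j h => ?_,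
    fun i j h => ?_⟩
  · rw [hτ, ZMod.natCast_zmod_val, add_sub_cancel]
  · apply e.injective
    apply add_right_cancel (b := 1)
    refine hf _ _ fun t ht => ?_
    have := h t ht
    simp only [hτ] at this
    convert this using 2 <;> push_cast <;> ring
  · apply e.injective
    apply sub_left_injective (b := ((8 * m : ℕ) : ZMod k))
    refine hf _ _ fun t ht => ?_
    have := h (8 * m - 1 - t) (by omega)
    simp only [hτ'] at this
    have hc : ((8 * m - 1 - t + 1 : ℕ) : ZMod k) = ((8 * m : ℕ) : ZMod k) - (t : ℕ) := by
      rw [eq_sub_iff_add_eq, ← Nat.cast_add]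
      congr 1
      omega
    rw [hc] at this
    convert this using 2 <;> ring

/-- The matrix of the deterministic transitions `j ↦ τ j`. -/
def transitionOfPerm {k : ℕ} (τ : Equiv.Perm (Fin k)) : Matrix (Fin k) (Fin k) ℝ :=
  Matrix.of fun i j => if i = τ j then 1 else 0

/-- The matrix of deterministic observations. -/
def observationOfWord {d k : ℕ} (g : Fin k → Fin d) : Matrix (Fin d) (Fin k) ℝ :=
  Matrix.of fun a i => if a = g i then 1 else 0

theorem transpose_transitionOfPerm {k : ℕ} (τ : Equiv.Perm (Fin k)) :
    (transitionOfPerm τ).transpose = transitionOfPerm τ⁻¹ := by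
  ext i j
  simp only [transitionOfPerm, transpose_apply, of_apply, Equiv.Perm.eq_inv_iff_eq, eq_comm]

theorem startMatrix_ofPerm {d k : ℕ} (τ : Equiv.Perm (Fin k)) (g : Fin k → Fin d)
    (r : Fin k → ℝ) (n : ℕ) (w : Fin n → Fin d) (i : Fin k) :
    startMatrix (transitionOfPerm τ) (observationOfWord g) r n w i
      = if w = fun t : Fin n => g ((τ ^ ((t : ℕ) + 1)) i) then r ((τ ^ n) i) else 0 := by
  induction n generalizing i with
  | zero =>
    rw [if_pos (Subsingleton.elim _ _)]
    rfl
  | succ n ih =>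
    rw [startMatrix, mul_apply, Finset.sum_eq_single (τ i)]
    · change observationOfWord g (w 0) (τ i) * startMatrix (transitionOfPerm τ)
        (observationOfWord g) r n (Fin.tail w) (τ i) * transitionOfPerm τ (τ i) i = _
      rw [ih]
      simp only [observationOfWord, transitionOfPerm, of_apply, if_true, mul_one, ite_mul, one_mul,
        zero_mul, ← ite_and]
      simp only [funext_iff, Fin.forall_fin_succ, Fin.tail, Fin.val_zero, Fin.val_succ, pow_succ _ n,
        pow_succ _ (_ + 1), Equiv.Perm.mul_apply, zero_add, pow_one]
    · intro j _ hj
      simp [transitionOfPerm, hj]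
    · simp

theorem det_gram_startMatrix_ne_zero {d k n : ℕ} {τ : Equiv.Perm (Fin k)} {g : Fin k → Fin d}
    {r : Fin k → ℝ} (hr : ∀ i, r i ≠ 0)
    (h : ∀ i j, (∀ t < n, g ((τ ^ (t + 1)) i) = g ((τ ^ (t + 1)) j)) → i = j) :
    ((startMatrix (transitionOfPerm τ) (observationOfWord g) r n).transpose
      * startMatrix (transitionOfPerm τ) (observationOfWord g) r n).det ≠ 0 := by
  have : (startMatrix (transitionOfPerm τ) (observationOfWord g) r n).transpose
      * startMatrix (transitionOfPerm τ) (observationOfWord g) r n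
      = diagonal fun i => r ((τ ^ n) i) * r ((τ ^ n) i) := by
    ext i j
    rw [mul_apply]
    simp only [transpose_apply, startMatrix_ofPerm, ite_mul, zero_mul, Finset.sum_ite_eq',
      Finset.mem_univ, if_true]
    by_cases hij : i = j
    · subst hij
      simp
    · rw [diagonal_apply_ne _ hij, if_neg, mul_zero]
      intro hw
      exact hij (h i j fun t ht => congrFun hw ⟨t, ht⟩)
  rw [this, det_diagonal]
  exact Finset.prod_ne_zero_iff.mpr fun i _ => mul_ne_zero (hr _) (hr _)

theorem sum_transitionOfPerm {k : ℕ} (τ : Equiv.Perm (Fin k)) (j : Fin k) :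
    ∑ i, transitionOfPerm τ i j = 1 := by
  simp [transitionOfPerm]

theorem transitionOfPerm_mulVec {k : ℕ} (τ : Equiv.Perm (Fin k)) (v : Fin k → ℝ) (i : Fin k) :
    (transitionOfPerm τ).mulVec v (τ i) = v i := by
  rw [mulVec, dotProduct, Finset.sum_eq_single i]
  · simp [transitionOfPerm]
  · intro j _ hj
    simp [transitionOfPerm, hj.symm]
  · simp

theorem det_stationaryMatrix_ofPerm_ne_zero {k : ℕ} (hk : 1 ≤ k) {τ : Equiv.Perm (Fin k)}
    (hτ : ∀ i j, ∃ t : ℕ, (τ ^ t) i = j) : (stationaryMatrix (transitionOfPerm τ)).det ≠ 0 := by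
  intro h
  obtain ⟨v, hv0, hv⟩ := exists_mulVec_eq_zero_iff.mpr h
  have hk0 : (k : ℝ) ≠ 0 := by
    exact_mod_cast (by omega : k ≠ 0)
  have hsum : ∑ i, v i = 0 := by
    have := sum_stationaryMatrix_mulVec (sum_transitionOfPerm τ) v
    rw [hv] at this
    simpa [hk0] using this.symm
  have hfix : ∀ i, v (τ i) = v i := by
    intro i
    have := congrFun hv (τ i)
    rw [stationaryMatrix_mulVec] at this
    simp only [Pi.add_apply, Pi.sub_apply, hsum, transitionOfPerm_mulVec, Pi.zero_apply,
      add_zero] at this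
    exact sub_eq_zero.mp this
  have hpow : ∀ (t : ℕ) i, v ((τ ^ t) i) = v i := by
    intro t
    induction t with
    | zero => intro i; rfl
    | succ t ih => intro i; rw [pow_succ, Equiv.Perm.mul_apply, ih, hfix]
  apply hv0
  ext i
  have hconst : ∀ j, v j = v i := fun j => by
    obtain ⟨t, rfl⟩ := hτ i j
    exact hpow t i
  simp_rw [hconst] at hsum
  simpa [hk0] using hsum

/-- The HMM with deterministic transitions and observations. -/
def HMM.ofPerm {d k : ℕ} (τ : Equiv.Perm (Fin k)) (g : Fin k → Fin d) : HMM d k where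
  Q := transitionOfPerm τ
  O := observationOfWord g
  Q_nonneg i j := by
    simp only [transitionOfPerm, of_apply]
    split_ifs <;> norm_num
  Q_sum := sum_transitionOfPerm τ
  O_nonneg a i := by
    simp only [observationOfWord, of_apply]
    split_ifs <;> norm_num
  O_sum i := by simp [observationOfWord]

theorem HMM.ofPerm_isStationary {d k : ℕ} (hk : 1 ≤ k) (τ : Equiv.Perm (Fin k))
    (g : Fin k → Fin d) : (HMM.ofPerm τ g).IsStationary fun _ => (k : ℝ)⁻¹ := by
  have hk0 : (k : ℝ) ≠ 0 := by
    exact_mod_cast (by omega : k ≠ 0)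
  refine ⟨fun _ => by positivity, by simp [hk0], ?_⟩
  ext i
  obtain ⟨j, rfl⟩ := τ.surjective i
  exact transitionOfPerm_mulVec τ _ j

/-- The space of affine coordinates of HMMs. -/
abbrev HMM.Coords (d k : ℕ) : Type :=
  ({i : Fin k // (i : ℕ) + 1 < k} → Fin k → ℝ) × ({a : Fin d // (a : ℕ) + 1 < d} → Fin k → ℝ)

theorem isAddHaarMeasure_volume_pi_pi (ι κ : Type*) [Fintype ι] [Fintype κ] :
    (volume : Measure (ι → κ → ℝ)).IsAddHaarMeasure :=
  Measure.pi.isAddHaarMeasure fun _ : ι => (volume : Measure (κ → ℝ))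

instance (d k : ℕ) : (volume : Measure (HMM.Coords d k)).IsAddHaarMeasure := by
  have := isAddHaarMeasure_volume_pi_pi {i : Fin k // (i : ℕ) + 1 < k} (Fin k)
  have := isAddHaarMeasure_volume_pi_pi {a : Fin d // (a : ℕ) + 1 < d} (Fin k)
  rw [Measure.volume_eq_prod]
  infer_instance

namespace HMM

variable {d k : ℕ}

theorem completeRows_coords_fst (θ : HMM d k) : completeRows θ.coords.1 = θ.Q :=
  completeRows_restrict θ.Q_sum

theorem completeRows_coords_snd (θ : HMM d k) : completeRows θ.coords.2 = θ.O :=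
  completeRows_restrict θ.O_sum

theorem completeRows_fst_mem (i j : Fin k) :
    (fun x : Coords d k => completeRows x.1 i j) ∈ linePolynomials (Coords d k) := by
  have := completeRows_mem_linePolynomials (ContinuousLinearMap.fst ℝ
    ({i : Fin k // (i : ℕ) + 1 < k} → Fin k → ℝ) ({a : Fin d // (a : ℕ) + 1 < d} → Fin k → ℝ)) i j
  simpa only [ContinuousLinearMap.coe_fst'] using this

theorem completeRows_snd_mem (a : Fin d) (i : Fin k) :
    (fun x : Coords d k => completeRows x.2 a i) ∈ linePolynomials (Coords d k) := by
  have := completeRows_mem_linePolynomials (ContinuousLinearMap.snd ℝ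
    ({i : Fin k // (i : ℕ) + 1 < k} → Fin k → ℝ) ({a : Fin d // (a : ℕ) + 1 < d} → Fin k → ℝ)) a i
  simpa only [ContinuousLinearMap.coe_snd'] using this

theorem measureZero_of_linePolynomial {F : Coords d k → ℝ} (hF : F ∈ linePolynomials (Coords d k))
    (θ₀ : HMM d k) (h₀ : F θ₀.coords ≠ 0) : MeasureZero {θ : HMM d k | F θ.coords = 0} := by
  refine measure_mono_null ?_ (measure_zeroSet_linePolynomial volume hF h₀)
  rintro _ ⟨θ, hθ, rfl⟩
  exact hθ

theorem MeasureZero.mono {E E' : Set (HMM d k)} (h : MeasureZero E') (hE : E ⊆ E') :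
    MeasureZero E :=
  measure_mono_null (Set.image_mono hE) h

theorem MeasureZero.union {E E' : Set (HMM d k)} (h : MeasureZero E) (h' : MeasureZero E') :
    MeasureZero (E ∪ E') := by
  rw [MeasureZero, Set.image_union]
  exact measure_union_null h h'

theorem MeasureZero.iUnion {ι : Type*} [Countable ι] {E : ι → Set (HMM d k)}
    (h : ∀ i, MeasureZero (E i)) : MeasureZero (⋃ i, E i) := by
  rw [MeasureZero, Set.image_iUnion]
  exact measure_iUnion_null h

/-- The genericity conditions on an HMM, for windows of length `N`. -/
structure IsGeneric (θ : HMM d k) (N : ℕ) : Prop where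
  Q_ne : ∀ i j, θ.Q i j ≠ 0
  O_ne : ∀ i j, i ≠ j → ∃ a, θ.O a i ≠ θ.O a j
  det_ne : (stationaryMatrix θ.Q).det ≠ 0
  forward : ((startMatrix θ.Q θ.O (fun _ => 1) N).transpose
    * startMatrix θ.Q θ.O (fun _ => 1) N).det ≠ 0
  backward : ((startMatrix θ.Q.transpose θ.O
      ((stationaryMatrix θ.Q).cramer fun _ => 1) N).transpose
    * startMatrix θ.Q.transpose θ.O ((stationaryMatrix θ.Q).cramer fun _ => 1) N).det ≠ 0

theorem stationaryMatrix_mem (i j : Fin k) :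
    (fun x : Coords d k => stationaryMatrix (completeRows x.1) i j)
      ∈ linePolynomials (Coords d k) :=
  add_mem (sub_mem (algebraMap_mem (linePolynomials (Coords d k)) ((1 : Matrix _ _ ℝ) i j))
    (completeRows_fst_mem i j)) (one_mem _)

/-- The HMM with uniform transitions and observations. -/
def uniform (hd : d ≠ 0) (hk : k ≠ 0) : HMM d k where
  Q := Matrix.of fun _ _ => (k : ℝ)⁻¹
  O := Matrix.of fun _ _ => (d : ℝ)⁻¹
  Q_nonneg _ _ := by simp
  Q_sum _ := by simp [hk]
  O_nonneg _ _ := by simp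
  O_sum _ := by simp [hd]

/-- The HMM with uniform transitions which observes a given state differently from the others. -/
def distinguishing (hd : 2 ≤ d) (hk : k ≠ 0) (i : Fin k) : HMM d k where
  Q := Matrix.of fun _ _ => (k : ℝ)⁻¹
  O := observationOfWord fun j => if j = i then ⟨1, by omega⟩ else ⟨0, by omega⟩
  Q_nonneg _ _ := by simp
  Q_sum _ := by simp [hk]
  O_nonneg a i := by
    simp only [observationOfWord, of_apply]
    split_ifs <;> norm_num
  O_sum i := by simp [observationOfWord]

theorem measureZero_not_isGeneric {m : ℕ} (hd : 2 ≤ d) (hk : 1 ≤ k) (hkm : k ≤ d ^ m) :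
    MeasureZero {θ : HMM d k | ¬ θ.IsGeneric (8 * m)} := by
  obtain ⟨τ, g, hτ, hf, hb⟩ := exists_perm_word hd hk hkm
  have hk0 : k ≠ 0 := by omega
  have hQ : ∀ i j, MeasureZero {θ : HMM d k | θ.Q i j = 0} := by
    intro i j
    refine (measureZero_of_linePolynomial (completeRows_fst_mem i j)
      (uniform (by omega) hk0) ?_).mono fun θ hθ => ?_
    · rw [completeRows_coords_fst]
      simp [uniform, hk0]
    · change completeRows θ.coords.1 i j = 0
      rw [completeRows_coords_fst]
      exact hθ
  have hO : ∀ i j, i ≠ j → MeasureZero {θ : HMM d k | ∀ a, θ.O a i = θ.O a j} := by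
    intro i j hij
    refine (measureZero_of_linePolynomial
      (sub_mem (completeRows_snd_mem ⟨1, by omega⟩ i) (completeRows_snd_mem ⟨1, by omega⟩ j))
      (distinguishing hd hk0 i) ?_).mono fun θ hθ => ?_
    · simp only [Pi.sub_apply, completeRows_coords_snd]
      simp [distinguishing, observationOfWord, hij.symm]
    · change completeRows θ.coords.2 _ i - completeRows θ.coords.2 _ j = 0
      rw [completeRows_coords_snd, hθ, sub_self]
  have hdet₀ : (stationaryMatrix (ofPerm τ g).Q).det ≠ 0 :=
    det_stationaryMatrix_ofPerm_ne_zero hk hτ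
  have hdet : MeasureZero {θ : HMM d k | (stationaryMatrix θ.Q).det = 0} := by
    refine (measureZero_of_linePolynomial (det_mem_linePolynomials stationaryMatrix_mem)
      (ofPerm τ g) ?_).mono fun θ hθ => ?_
    · rwa [completeRows_coords_fst]
    · change (stationaryMatrix (completeRows θ.coords.1)).det = 0
      rw [completeRows_coords_fst]
      exact hθ
  have hforward : MeasureZero {θ : HMM d k | ((startMatrix θ.Q θ.O (fun _ => 1) (8 * m)).transpose
      * startMatrix θ.Q θ.O (fun _ => 1) (8 * m)).det = 0} := by
    refine (measureZero_of_linePolynomial (det_gram_mem_linePolynomials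
      (startMatrix_mem_linePolynomials completeRows_fst_mem completeRows_snd_mem
        (r := fun _ _ => 1) (fun _ => one_mem _) (8 * m))) (ofPerm τ g) ?_).mono fun θ hθ => ?_
    · rw [completeRows_coords_fst, completeRows_coords_snd]
      exact det_gram_startMatrix_ne_zero (fun _ => one_ne_zero) hf
    · simp only [Set.mem_ofPred_eq, completeRows_coords_fst, completeRows_coords_snd]
      exact hθ
  have hbackward : MeasureZero {θ : HMM d k | ((startMatrix θ.Q.transpose θ.O
      ((stationaryMatrix θ.Q).cramer fun _ => 1) (8 * m)).transpose * startMatrix θ.Q.transpose θ.O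
        ((stationaryMatrix θ.Q).cramer fun _ => 1) (8 * m)).det = 0} := by
    refine (measureZero_of_linePolynomial (det_gram_mem_linePolynomials
      (startMatrix_mem_linePolynomials (Q := fun x => (completeRows x.1).transpose)
        (fun i j => completeRows_fst_mem j i) completeRows_snd_mem
        (cramer_mem_linePolynomials (b := fun _ => 1) stationaryMatrix_mem) (8 * m)))
      (ofPerm τ g) ?_).mono fun θ hθ => ?_
    · rw [completeRows_coords_fst, completeRows_coords_snd,
        (ofPerm_isStationary hk τ g).cramer_eq hdet₀]
      change ((startMatrix (transitionOfPerm τ).transpose (observationOfWord g) _ _).transpose *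
        startMatrix (transitionOfPerm τ).transpose (observationOfWord g) _ _).det ≠ 0
      rw [transpose_transitionOfPerm]
      refine det_gram_startMatrix_ne_zero (fun i => mul_ne_zero hdet₀ (inv_ne_zero ?_)) hb
      exact_mod_cast hk0
    · simp only [Set.mem_ofPred_eq, completeRows_coords_fst, completeRows_coords_snd]
      exact hθ
  refine ((((MeasureZero.iUnion fun i => MeasureZero.iUnion fun j => hQ i j).union
    (MeasureZero.iUnion fun z : {z : Fin k × Fin k // z.1 ≠ z.2} => hO z.1.1 z.1.2 z.2)).union
    hdet).union (hforward.union hbackward)).mono fun θ hθ => ?_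
  by_contra hn
  simp only [Set.mem_union, Set.mem_iUnion, Set.mem_ofPred_eq, not_or, not_exists, Subtype.forall,
    Prod.forall, not_forall] at hn
  obtain ⟨⟨⟨h1, h2⟩, h3⟩, h4, h5⟩ := hn
  exact hθ ⟨h1, h2, h3, h4, h5⟩

end HMM

theorem le_pow_toNat_ceil_logb {d k : ℕ} (hd : 2 ≤ d) (hk : 1 ≤ k) :
    k ≤ d ^ ⌈Real.logb d k⌉.toNat := by
  have h1 : Real.logb d k ≤ (⌈Real.logb d k⌉.toNat : ℝ) :=
    (Int.le_ceil _).trans (by exact_mod_cast Int.self_le_toNat _)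
  rw [Real.logb_le_iff_le_rpow (by exact_mod_cast hd) (by exact_mod_cast hk),
    Real.rpow_natCast] at h1
  exact_mod_cast h1

end

end

theorem theorem3 (d k : ℕ) (hd : 2 ≤ d) (hk : 1 ≤ k) :
    ∃ E : Set (HMM d k), HMM.MeasureZero E ∧ ∀ θ : HMM d k, θ ∉ E →
      -- the stationary state distribution exists, is unique and is positive
      ∃ (p : Fin k → ℝ) (hp : θ.IsStationary p),
        (∀ p', θ.IsStationary p' → p' = p) ∧ (∀ i, 0 < p i) ∧
        ∀ n : ℕ, 8 * ⌈Real.logb d k⌉ < (n : ℤ) →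
          -- the factors have full column rank
          (θ.factorA n).rank = k ∧ (θ.factorB p n).rank = k ∧
          -- the tensor of the joint probabilities of length `2 n + 1` decomposes into them
          tensorM (fun l : Fin (2 * n + 1) → Fin d => θ.prob p l)
            = tensorOf (θ.factorA n) (θ.factorB p n) (θ.factorC p) ∧
          -- this is its rank decomposition, unique up to common column permutation and scaling
          (∀ (k' : ℕ) (A' B' : Matrix (Fin n → Fin d) (Fin k') ℝ)
              (C' : Matrix (Fin d) (Fin k') ℝ),
            tensorM (fun l : Fin (2 * n + 1) → Fin d => θ.prob p l) = tensorOf A' B' C' →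
            k ≤ k' ∧
            (k' = k → ∃ (σ : Fin k' ≃ Fin k) (a b c : Fin k' → ℝ), ∀ i,
              a i * b i * c i = 1 ∧
              (∀ w, A' w i = a i * θ.factorA n w (σ i)) ∧
              (∀ w, B' w i = b i * θ.factorB p n w (σ i)) ∧
              (∀ y, C' y i = c i * θ.factorC p y (σ i)))) ∧
          -- and if it has `k` states then it is `θ` up to a permutation of the states
          (∀ (k' : ℕ) (θ' : HMM d k') (p' : Fin k' → ℝ), θ'.IsStationary p' →
            (∀ l : Fin (2 * n + 1) → Fin d, θ'.prob p' l = θ.prob p l) →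
            k ≤ k' ∧
            (k' = k → ∃ σ : Fin k' ≃ Fin k,
              θ'.Q = θ.Q.submatrix σ σ ∧ θ'.O = θ.O.submatrix id σ ∧ p' = p ∘ σ)) ∧
          -- for almost all unit vectors `v₁`, `v₂`, the realization procedure applied to the joint
          -- probabilities of length `2 n + 1` has an output, and every output is the order `k` and
          -- the matrices `Q`, `O` up to a permutation of the states
          (∀ᵐ v ∂((sphereMeasure d).prod (sphereMeasure d)),
            (∃ (Q' : Matrix (Fin k) (Fin k) ℝ) (O' : Matrix (Fin d) (Fin k) ℝ),
              IsRealizationOutput (fun l : Fin (2 * n + 1) → Fin d => θ.prob p l)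
                v.1 v.2 Q' O') ∧
            ∀ (k' : ℕ) (Q' : Matrix (Fin k') (Fin k') ℝ) (O' : Matrix (Fin d) (Fin k') ℝ),
              IsRealizationOutput (fun l : Fin (2 * n + 1) → Fin d => θ.prob p l)
                v.1 v.2 Q' O' →
              ∃ σ : Fin k' ≃ Fin k, Q' = θ.Q.submatrix σ σ ∧ O' = θ.O.submatrix id σ) ∧
          -- the strings of length `2 n + 1` has order at least `k`, and is equivalent to it if it
          -- has order `k`
          (∀ (L : ℕ) (l : Fin (L + 1) → Fin d), (θ.toQuasi p hp).prob l = θ.prob p l) ∧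
          (∀ (k' : ℕ) (q : QuasiHMM d k'),
            (∀ l : Fin (2 * n + 1) → Fin d, q.prob l = θ.prob p l) → k ≤ k') ∧
          (∀ q : QuasiHMM d k,
            (∀ l : Fin (2 * n + 1) → Fin d, q.prob l = θ.prob p l) →
            (θ.toQuasi p hp).Equivalent q) := by
  refine ⟨_, HMM.measureZero_not_isGeneric hd hk (le_pow_toNat_ceil_logb hd hk), fun θ hθ => ?_⟩
  replace hθ : θ.IsGeneric (8 * ⌈Real.logb d k⌉.toNat) := not_not.mp hθ
  have hO : ∀ i i', (∀ a, θ.O a i = θ.O a i') → i = i' := by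
    intro i i' h
    by_contra hne
    obtain ⟨a, ha⟩ := hθ.O_ne i i' hne
    exact ha (h a)
  obtain ⟨p, hp, huniq, hpos⟩ := θ.exists_stationary hk
    (fun i j => lt_of_le_of_ne (θ.Q_nonneg i j) (hθ.Q_ne i j).symm) hθ.det_ne
  have hp0 : ∀ i, p i ≠ 0 := fun i => (hpos i).ne'
  refine ⟨p, hp, huniq, hpos, fun n hn => ?_⟩
  have hlog : 0 ≤ ⌈Real.logb d k⌉ :=
    Int.ceil_nonneg (Real.logb_nonneg (by exact_mod_cast hd) (by exact_mod_cast hk))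
  obtain ⟨n, rfl⟩ : ∃ n', n = n' + 1 := Nat.exists_eq_add_one.mpr (by omega)
  have hle : 8 * ⌈Real.logb d k⌉.toNat ≤ n := by omega
  have hAn : (θ.factorA n).rank = k := by
    refine HMM.rank_factorA_mono hp hle ?_
    rw [HMM.factorA, ← startMatrix_one]
    exact Matrix.rank_eq_of_isUnit_det_mul hθ.forward.isUnit
  have hA : (θ.factorA (n + 1)).rank = k := HMM.rank_factorA_mono hp n.le_succ hAn
  have hB : (θ.factorB p (n + 1)).rank = k := by
    refine HMM.rank_factorB_mono hp hpos (hle.trans n.le_succ) ?_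
    have h := Matrix.rank_eq_of_isUnit_det_mul hθ.backward.isUnit
    rw [hp.cramer_eq hθ.det_ne, startMatrix_smul, θ.startMatrix_eq_factorB hpos,
      ← Matrix.mul_smul] at h
    exact Matrix.rank_eq_of_rank_mul h
  have hM := θ.tensorM_eq hp hpos (n + 1)
  have hQ : IsUnit θ.Q.det := HMM.isUnit_det_Q hA
  have hT : IsUnit (∑ a, (θ.toQuasi p hp).T a).det := by rwa [HMM.sum_toQuasi_T]
  have hfut := HMM.rank_future hp hA
  have hpast := (HMM.rank_past hp hpos (n + 1)).trans hB
  have hprob : ∀ {L : ℕ} (l : Fin (L + 1) → Fin d), (θ.toQuasi p hp).prob l = θ.prob p l :=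
    θ.toQuasi_prob hp
  have hmin : ∀ (k' : ℕ) (q : QuasiHMM d k'),
      (∀ l : Fin (2 * (n + 1) + 1) → Fin d, q.prob l = θ.prob p l) → k ≤ k' := fun k' q h =>
    QuasiHMM.le_of_prob_eq hfut hpast hT fun l => (h l).trans (hprob l).symm
  have hequiv : ∀ q : QuasiHMM d k,
      (∀ l : Fin (2 * (n + 1) + 1) → Fin d, q.prob l = θ.prob p l) →
      (θ.toQuasi p hp).Equivalent q := fun q h =>
    QuasiHMM.equivalent_of_prob_eq (HMM.rank_future hp hAn) hpast hT
      fun l => (h l).trans (hprob l).symm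
  refine ⟨hA, hB, hM, ?_, ?_, ?_, fun L l => hprob l, hmin, hequiv⟩
  · intro k' A' B' C' h
    exact tensorOf_unique hA hB θ.O_sum hO hp0 (hM.symm.trans h)
  · intro k' θ' p' hp' h
    have h' : ∀ l : Fin (2 * (n + 1) + 1) → Fin d, (θ'.toQuasi p' hp').prob l = θ.prob p l :=
      fun l => (θ'.toQuasi_prob hp' l).trans (h l)
    refine ⟨hmin k' _ h', ?_⟩
    rintro rfl
    exact HMM.exists_perm_of_equivalent hp hp' hQ hO (hequiv _ h')
  · filter_upwards [ae_sphereMeasure_prod_injective θ.O_sum hO hp0] with v hv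
    obtain ⟨h1, h2, hinj⟩ := hv
    have hsA := HMM.sum_factorA hp (n + 1)
    have hsB := HMM.sum_factorB hp hpos (n + 1)
    constructor
    · refine ⟨_, _, θ.factorA (n + 1), θ.factorB p (n + 1), θ.factorC p, ?_, rfl, rfl⟩
      rw [hM]
      exact isDecompositionOutput_tensorOf hA hB hsA hsB h1 h2
    · rintro k' Q' O' ⟨A', B', C', hout, rfl, rfl⟩
      rw [hM] at hout
      obtain ⟨σ, rfl, rfl⟩ := hout.exists_perm hA hB hsA hsB h1 h2 hinj
      have hrO : recoverO ((θ.O * Matrix.diagonal p).submatrix id σ) = θ.O.submatrix id σ :=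
        HMM.recoverO_factorC hpos σ
      exact ⟨σ, by rw [hrO, HMM.recoverQ_factorA hp hA σ], hrO⟩
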